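/- **Setting.** Let $(\overline M,\overline g)$ be a Lorentzian manifold of dimension $n+2$ with Levi-Civita connection $\overline\nabla$, and let $M$ be an immersed lightlike hypersurface of $\overline M$, of dimension $n+1$, with induced degenerate metric $g=\langle\cdot,\cdot\rangle$, whose radical distribution $\mathrm{Rad}\,TM=TM\cap TM^\perp$ is spanned by a globally defined, nowhere vanishing smooth null vector field $\xi$. Fix a screen distribution, i.e. a smooth distribution $S(TM)$ with $TM=S(TM)\oplus \mathrm{Rad}\,TM$, and let $P:TM\to S(TM)$ be the corresponding projection. Let $N$ be the unique section of $T\overline M|_M$ with $\overline g(N,\xi)=1$ and $\overline g(N,N)=\overline g(N,W)=0$ for all $W\in S(TM)$; put $\eta=\overline g(N,\cdot)$ on $TM$, $X^\flat=g(X,\cdot)+\eta(X)\eta$ and $\tilde g(X,Y)=X^\flat(Y)$ (which is nondegenerate). The induced connection is $\nabla_XY=Q(\overline\nabla_XY)$, where $Q$ is the projection onto $TM$ in $T\overline M|_M=TM\oplus\mathrm{span}\{N\}$. Assume that $M$ is totally geodesic in $\overline M$, i.e. $\overline\nabla_XY=\nabla_XY$ for all $X,Y\in\Gamma(TM)$.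 The gradient $\nabla^g f$ of a smooth function $f$ on $M$ is defined by $\tilde g(\nabla^g f,X)=df(X)$ for all $X$. An $\mathcal A^\nabla$-tensor on $(M,g,S(TM))$ is a smooth field $S$ of endomorphisms of $TM$ such that $PS=SP$, $\langle SX,Y\rangle=\langle X,SY\rangle$ for all $X,Y$, and $X^\flat(\nabla S(X,X))=0$ for all $X$, where $\nabla S(X,Y)=(\nabla_XS)Y=\nabla_X(SY)-S(\nabla_XY)$. **Corollary 7.4.** Let $S$ be an $\mathcal A^\nabla$-tensor on $(M,g,S(TM))$ with eigenfunctions $\lambda_0,\lambda_1,\dots,\lambda_k$: smooth functions on $M$ whose values at each point $x\in M$ are pairwise distinct and are precisely the eigenvalues of $S_x$. Put $D_\alpha=\mathrm{Ker}(\lambda_\alpha I-S)$, numbered so that $D_0=\mathrm{Rad}\,TM$. Assume that 1. $\nabla^g\lambda_0,\nabla^g\lambda_1,\dots,\nabla^g\lambda_k$ take values in $\mathrm{Rad}\,TM=D_0$; 2. $(D_0,\dots,D_k)$ is an integrable almost product structure, i.e. for every subset $A\subset\{0,\dots,k\}$ the distribution $\bigoplus_{\alpha\in A}D_\alpha$ is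 integrable (its sections are closed under the Lie bracket); 3. the leaves of the screen distribution are totally geodesic in $M$, i.e. $C(X,Y)=\eta(\nabla_XY)=0$ for all $X,Y\in\Gamma(S(TM))$. Then $\nabla S=0$ on $S(TM)\times S(TM)$, i.e. $(\nabla_XS)Y=0$ for all $X,Y\in\Gamma(S(TM))$. -/

import Mathlib

open scoped Manifold ContDiff Topology
open Bundle

noncomputable section

namespace NullGeometry

/-! ### Vector fields, distributions, tensors on a manifold modelled on `ℝ^d` -/

section Manifold

variable {d : ℕ} {N : Type*} [TopologicalSpace N]
  [ChartedSpace (EuclideanSpace ℝ (Fin d)) N] [IsManifold (𝓡 d) ∞ N]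

/-- `X` is a smooth vector field. -/
def SmoothField (X : ∀ x : N, TangentSpace (𝓡 d) x) : Prop :=
  ContMDiff (𝓡 d) (𝓡 d).tangent ∞ (fun x => (⟨x, X x⟩ : TangentBundle (𝓡 d) N))

/-- `X ∈ Γ(D)`: `X` is a smooth vector field with values in the distribution `D`. -/
def IsSection (D : ∀ x : N, Submodule ℝ (TangentSpace (𝓡 d) x))
    (X : ∀ x : N, TangentSpace (𝓡 d) x) : Prop :=
  SmoothField X ∧ ∀ x, X x ∈ D x

/-- `D` is a smooth distribution (vector subbundle of the tangent bundle): it has constant rank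
and is spanned near each point by linearly independent smooth vector fields. -/
def IsSmoothDistribution (D : ∀ x : N, Submodule ℝ (TangentSpace (𝓡 d) x)) : Prop :=
  ∃ r : ℕ, ∀ x : N, ∃ V : Fin r → ∀ y : N, TangentSpace (𝓡 d) y,
    (∀ a, SmoothField (V a)) ∧
      ∀ᶠ y in 𝓝 x, LinearIndependent ℝ (fun a => V a y) ∧
        Submodule.span ℝ (Set.range fun a => V a y) = D y

/-- `D` is integrable (involutive): `Γ(D)` is closed under the Lie bracket. -/
def Integrable (D : ∀ x : N, Submodule ℝ (TangentSpace (𝓡 d) x)) : Prop :=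
  ∀ X Y : ∀ x : N, TangentSpace (𝓡 d) x, IsSection D X → IsSection D Y →
    ∀ x, VectorField.mlieBracket (𝓡 d) X Y x ∈ D x

/-- A finite family `(D_α)` of distributions is an integrable almost product structure: the sum of
any subfamily is integrable. -/
def IntegrableAlmostProduct {ι : Type*} (D : ι → ∀ x : N, Submodule ℝ (TangentSpace (𝓡 d) x)) :
    Prop :=
  ∀ A : Finset ι, Integrable (fun x => ⨆ α ∈ A, D α x)

/-- A field of endomorphisms `S` of the tangent bundle is smooth, i.e. a smooth
`(1,1)`-tensor field. -/
def SmoothEnd (S : ∀ x : N, TangentSpace (𝓡 d) x →L[ℝ] TangentSpace (𝓡 d) x) : Prop :=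
  ContMDiff (𝓡 d) ((𝓡 d).prod
      𝓘(ℝ, EuclideanSpace ℝ (Fin d) →L[ℝ] EuclideanSpace ℝ (Fin d))) ∞
    (fun x => TotalSpace.mk' (EuclideanSpace ℝ (Fin d) →L[ℝ] EuclideanSpace ℝ (Fin d))
      (E := fun x : N => TangentSpace (𝓡 d) x →L[ℝ] TangentSpace (𝓡 d) x) x (S x))

/-- The eigenspace distribution `Ker(f I - S)` of a function `f`. -/
def eigenDistribution
    (S : ∀ x : N, TangentSpace (𝓡 d) x →L[ℝ] TangentSpace (𝓡 d) x)
    (f : N → ℝ) (x : N) : Submodule ℝ (TangentSpace (𝓡 d) x) :=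
  Module.End.eigenspace (S x).toLinearMap (f x)

/-- The components, in the coordinate frame of the preferred chart at `q`, of a vector tangent
at `y`. -/
def comp (q y : N) (u : TangentSpace (𝓡 d) y) : EuclideanSpace ℝ (Fin d) :=
  (trivializationAt (EuclideanSpace ℝ (Fin d)) (TangentSpace (𝓡 d)) q).continuousLinearMapAt ℝ y u

/-- The vector at `y` with components `c` in the coordinate frame of the preferred chart at `q`.
For fixed `c` this is a constant linear combination of the coordinate fields `∂_k`. -/
def coordField (q : N) (c : EuclideanSpace ℝ (Fin d)) (y : N) : TangentSpace (𝓡 d) y :=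
  (trivializationAt (EuclideanSpace ℝ (Fin d)) (TangentSpace (𝓡 d)) q).symmL ℝ y c

/-- The derivative of a function `f` at `x` in the direction `v`. -/
def dirDeriv {F : Type*} [NormedAddCommGroup F] [NormedSpace ℝ F] (f : N → F) (x : N)
    (v : TangentSpace (𝓡 d) x) : F :=
  mfderiv (𝓡 d) 𝓘(ℝ, F) f x v

end Manifold

/-- The vector that represents the linear form `θ` with respect to the bilinear form `B`, i.e. the
`z` with `B z w = θ w` for all `w` (it exists and is unique for nondegenerate `B`). -/
def representing {T : Type*} [AddCommGroup T] [Module ℝ T] (B : T → T → ℝ) (θ : T → ℝ) : T :=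
  Classical.epsilon fun z => ∀ w, B z w = θ w

/-! ### Lorentzian manifolds and the Levi-Civita connection -/

/-- A Lorentzian metric (signature `(-,+,…,+)`) on a manifold of dimension `n + 2`. -/
structure LorentzMetric (n : ℕ) (N : Type*) [TopologicalSpace N]
    [ChartedSpace (EuclideanSpace ℝ (Fin (n + 2))) N] [IsManifold (𝓡 (n + 2)) ∞ N] where
  val : ∀ x : N, TangentSpace (𝓡 (n + 2)) x →L[ℝ] TangentSpace (𝓡 (n + 2)) x →L[ℝ] ℝ
  symm : ∀ (x : N) (v w : TangentSpace (𝓡 (n + 2)) x), val x v w = val x w v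
  lorentzian : ∀ x : N, ∃ b : Module.Basis (Fin (n + 2)) ℝ (TangentSpace (𝓡 (n + 2)) x),
    ∀ i j, val x (b i) (b j) = if i = j then (if i = 0 then -1 else 1) else 0
  contMDiff : ContMDiff (𝓡 (n + 2)) ((𝓡 (n + 2)).prod
      𝓘(ℝ, EuclideanSpace ℝ (Fin (n + 2)) →L[ℝ] EuclideanSpace ℝ (Fin (n + 2)) →L[ℝ] ℝ)) ∞
    (fun x => TotalSpace.mk'
      (EuclideanSpace ℝ (Fin (n + 2)) →L[ℝ] EuclideanSpace ℝ (Fin (n + 2)) →L[ℝ] ℝ)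
      (E := fun x : N =>
        TangentSpace (𝓡 (n + 2)) x →L[ℝ] TangentSpace (𝓡 (n + 2)) x →L[ℝ] ℝ) x (val x))

section LeviCivita

variable {n : ℕ} {N : Type*} [TopologicalSpace N]
  [ChartedSpace (EuclideanSpace ℝ (Fin (n + 2))) N] [IsManifold (𝓡 (n + 2)) ∞ N]
  {M : Type*} [TopologicalSpace M]
  [ChartedSpace (EuclideanSpace ℝ (Fin (n + 1))) M] [IsManifold (𝓡 (n + 1)) ∞ M]

/-- The Christoffel symbol of `g` at `q` in the preferred chart at `q`:
`Γ(u, v) = u^i v^j Γ^k_{ij} ∂_k`, where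
`g (Γ(∂_i, ∂_j), ∂_l) = (∂_i g_{jl} + ∂_j g_{il} - ∂_l g_{ij}) / 2`. -/
def christoffel (g : LorentzMetric n N) (q : N) (u v : TangentSpace (𝓡 (n + 2)) q) :
    TangentSpace (𝓡 (n + 2)) q :=
  representing (fun z w => g.val q z w) fun w =>
    (dirDeriv (fun y => g.val y (coordField q (comp q q v) y) (coordField q (comp q q w) y)) q u
      + dirDeriv (fun y => g.val y (coordField q (comp q q u) y) (coordField q (comp q q w) y)) q v
      - dirDeriv (fun y => g.val y (coordField q (comp q q u) y) (coordField q (comp q q v) y)) q w)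
      / 2

/-- The Levi-Civita derivative `∇̄_v V` at `x` of a vector field `V` along `i : M → N` in the
direction `v ∈ T_x M`; in coordinates around `i x` it is
`(v(V^k) + Γ^k_{ij} (di v)^i V^j) ∂_k`. -/
def leviCivitaAlong (g : LorentzMetric n N) (i : M → N)
    (V : ∀ x : M, TangentSpace (𝓡 (n + 2)) (i x)) (x : M) (v : TangentSpace (𝓡 (n + 1)) x) :
    TangentSpace (𝓡 (n + 2)) (i x) :=
  coordField (i x) (dirDeriv (fun y => comp (i x) (i y) (V y)) x v) (i x)
    + christoffel g (i x) (mfderiv (𝓡 (n + 1)) (𝓡 (n + 2)) i x v) (V x)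

/-- The first fundamental form (pulled back metric) of `i : M → N`. -/
def inducedMetric (g : LorentzMetric n N) (i : M → N) (x : M)
    (v w : TangentSpace (𝓡 (n + 1)) x) : ℝ :=
  g.val (i x) (mfderiv (𝓡 (n + 1)) (𝓡 (n + 2)) i x v) (mfderiv (𝓡 (n + 1)) (𝓡 (n + 2)) i x w)

/-- The radical `Rad T_x M = T_x M ∩ T_x M^⊥` of the induced metric. -/
def radical (g : LorentzMetric n N) (i : M → N) (x : M) :
    Submodule ℝ (TangentSpace (𝓡 (n + 1)) x) where
  carrier := {v | ∀ w, inducedMetric g i x v w = 0}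
  add_mem' := by
    intro a b ha hb w
    have h1 := ha w
    have h2 := hb w
    simp only [inducedMetric, map_add, add_apply] at *
    rw [h1, h2, add_zero]
  zero_mem' := by intro w; simp [inducedMetric]
  smul_mem' := by
    intro c a ha w
    have h1 := ha w
    simp only [inducedMetric, map_smul, smul_apply] at *
    rw [h1, smul_zero]

end LeviCivita

/-! ### Lightlike hypersurfaces -/

/-- A lightlike hypersurface `(M, g, S(TM))` of the Lorentzian manifold `(N, gbar)` with a given
screen distribution, whose radical distribution is spanned by a global null vector field `ξ`. -/
structure LightlikeHypersurface (n : ℕ) (N : Type*) [TopologicalSpace N]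
    [ChartedSpace (EuclideanSpace ℝ (Fin (n + 2))) N] [IsManifold (𝓡 (n + 2)) ∞ N]
    (M : Type*) [TopologicalSpace M]
    [ChartedSpace (EuclideanSpace ℝ (Fin (n + 1))) M] [IsManifold (𝓡 (n + 1)) ∞ M] where
  /-- the metric of the ambient manifold -/
  gbar : LorentzMetric n N
  /-- the immersion of the hypersurface -/
  i : M → N
  contMDiff_i : ContMDiff (𝓡 (n + 1)) (𝓡 (n + 2)) ∞ i
  injective_mfderiv : ∀ x, Function.Injective (mfderiv (𝓡 (n + 1)) (𝓡 (n + 2)) i x)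
  /-- the global null vector field -/
  ξ : ∀ x : M, TangentSpace (𝓡 (n + 1)) x
  smooth_ξ : SmoothField ξ
  ξ_ne_zero : ∀ x, ξ x ≠ 0
  radical_eq : ∀ x, radical gbar i x = Submodule.span ℝ {ξ x}
  /-- the screen distribution -/
  screen : ∀ x : M, Submodule ℝ (TangentSpace (𝓡 (n + 1)) x)
  smooth_screen : IsSmoothDistribution screen
  isCompl_screen : ∀ x, IsCompl (screen x) (radical gbar i x)

namespace LightlikeHypersurface

variable {n : ℕ} {N : Type*} [TopologicalSpace N]
  [ChartedSpace (EuclideanSpace ℝ (Fin (n + 2))) N] [IsManifold (𝓡 (n + 2)) ∞ N]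
  {M : Type*} [TopologicalSpace M]
  [ChartedSpace (EuclideanSpace ℝ (Fin (n + 1))) M] [IsManifold (𝓡 (n + 1)) ∞ M]
  (L : LightlikeHypersurface n N M)

/-- The differential of the immersion, `T_x M → T_{i x} N`. -/
def di (x : M) : TangentSpace (𝓡 (n + 1)) x →L[ℝ] TangentSpace (𝓡 (n + 2)) (L.i x) :=
  mfderiv (𝓡 (n + 1)) (𝓡 (n + 2)) L.i x

/-- The degenerate metric induced on `M`. -/
def g (x : M) (v w : TangentSpace (𝓡 (n + 1)) x) : ℝ := inducedMetric L.gbar L.i x v w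

/-- The radical distribution `Rad TM = TM^⊥`. -/
def rad (x : M) : Submodule ℝ (TangentSpace (𝓡 (n + 1)) x) := radical L.gbar L.i x

/-- `u` is the null transversal vector at `x` normalized by `ξ` and the screen:
`gbar(u, ξ) = 1` and `gbar(u, u) = gbar(u, w) = 0` for `w` in the screen. -/
def IsTransversal (x : M) (u : TangentSpace (𝓡 (n + 2)) (L.i x)) : Prop :=
  L.gbar.val (L.i x) u (L.di x (L.ξ x)) = 1 ∧ L.gbar.val (L.i x) u u = 0 ∧
    ∀ w ∈ L.screen x, L.gbar.val (L.i x) u (L.di x w) = 0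

/-- The section `N` of the transversal bundle `tr(TM)` that is normalized by `ξ`. -/
def transversal (x : M) : TangentSpace (𝓡 (n + 2)) (L.i x) :=
  Classical.epsilon (L.IsTransversal x)

/-- The projection `Q` onto `TM` in the decomposition `TN|_M = TM ⊕ tr(TM)`. -/
def Q (x : M) (u : TangentSpace (𝓡 (n + 2)) (L.i x)) : TangentSpace (𝓡 (n + 1)) x :=
  Classical.epsilon fun v => u - L.di x v ∈ Submodule.span ℝ {L.transversal x}

/-- `∇̄_X Y` along `M`, for vector fields `X`, `Y` on `M`. -/
def nablaBar (X Y : ∀ x : M, TangentSpace (𝓡 (n + 1)) x) (x : M) :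
    TangentSpace (𝓡 (n + 2)) (L.i x) :=
  leviCivitaAlong L.gbar L.i (fun y => L.di y (Y y)) x (X x)

/-- The induced connection `∇_X Y = Q(∇̄_X Y)`. -/
def nabla (X Y : ∀ x : M, TangentSpace (𝓡 (n + 1)) x) (x : M) : TangentSpace (𝓡 (n + 1)) x :=
  L.Q x (L.nablaBar X Y x)

/-- The second fundamental form `h(X, Y) = ∇̄_X Y - ∇_X Y` of `M`. -/
def secondFundamentalForm (X Y : ∀ x : M, TangentSpace (𝓡 (n + 1)) x) (x : M) :
    TangentSpace (𝓡 (n + 2)) (L.i x) :=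
  L.nablaBar X Y x - L.di x (L.nabla X Y x)

/-- `M` is totally geodesic in the ambient manifold. -/
def TotallyGeodesic : Prop :=
  ∀ X Y : ∀ x : M, TangentSpace (𝓡 (n + 1)) x, SmoothField X → SmoothField Y →
    ∀ x, L.secondFundamentalForm X Y x = 0

/-- The one-form `η = gbar(N, ·)`. -/
def η (x : M) (v : TangentSpace (𝓡 (n + 1)) x) : ℝ :=
  L.gbar.val (L.i x) (L.transversal x) (L.di x v)

/-- The projection `P` onto the screen in the decomposition `TM = S(TM) ⊕ Rad TM`. -/
def P (x : M) : TangentSpace (𝓡 (n + 1)) x →ₗ[ℝ] TangentSpace (𝓡 (n + 1)) x :=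
  Submodule.projection (L.screen x) (L.rad x) (L.isCompl_screen x)

/-- The duality `X ↦ X^♭ = g(X, ·) + η(X) η(·)`. As a bilinear form it is the associated
nondegenerate metric `g̃(X, Y) = X^♭(Y)`. -/
def flat (x : M) (v w : TangentSpace (𝓡 (n + 1)) x) : ℝ := L.g x v w + L.η x v * L.η x w

/-- The gradient `∇^g f` with respect to the degenerate metric: `g̃(∇^g f, X) = df(X)`. -/
def grad (f : M → ℝ) (x : M) : TangentSpace (𝓡 (n + 1)) x :=
  representing (L.flat x) (dirDeriv f x)

/-- The second fundamental form of the screen distribution,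
`h^*(X, PY) = ∇_X PY - P(∇_X PY)`. -/
def screenSecondFundamentalForm (X Y : ∀ x : M, TangentSpace (𝓡 (n + 1)) x) (x : M) :
    TangentSpace (𝓡 (n + 1)) x :=
  L.nabla X (fun y => L.P y (Y y)) x - L.P x (L.nabla X (fun y => L.P y (Y y)) x)

/-- `C(X, PY) = gbar(h^*(X, PY), N)`. -/
def C (X Y : ∀ x : M, TangentSpace (𝓡 (n + 1)) x) (x : M) : ℝ :=
  L.η x (L.screenSecondFundamentalForm X Y x)

/-- The leaves of the screen distribution are totally geodesic in `M`: `C` vanishes on vectors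
tangent to the screen. -/
def ScreenTotallyGeodesic : Prop :=
  ∀ X Y : ∀ x : M, TangentSpace (𝓡 (n + 1)) x, IsSection L.screen X → IsSection L.screen Y →
    ∀ x, L.C X Y x = 0

/-- The covariant derivative `∇S(X, Y) = (∇_X S)Y = ∇_X(SY) - S(∇_X Y)` of a `(1,1)`-tensor. -/
def nablaEnd (S : ∀ x : M, TangentSpace (𝓡 (n + 1)) x →L[ℝ] TangentSpace (𝓡 (n + 1)) x)
    (X Y : ∀ x : M, TangentSpace (𝓡 (n + 1)) x) (x : M) : TangentSpace (𝓡 (n + 1)) x :=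
  L.nabla X (fun y => S y (Y y)) x - S x (L.nabla X Y x)

/-- `S` is an `𝒜^∇`-tensor on `(M, g, S(TM))`: a smooth, screen preserving field of endomorphisms
that is symmetric for `g` and satisfies `X^♭(∇S(X, X)) = 0`. -/
structure IsATensor
    (S : ∀ x : M, TangentSpace (𝓡 (n + 1)) x →L[ℝ] TangentSpace (𝓡 (n + 1)) x) : Prop where
  smooth : SmoothEnd S
  screen_preserving : ∀ (x : M) (v : TangentSpace (𝓡 (n + 1)) x), L.P x (S x v) = S x (L.P x v)
  symmetric : ∀ (x : M) (v w : TangentSpace (𝓡 (n + 1)) x), L.g x (S x v) w = L.g x v (S x w)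
  flat_nablaEnd : ∀ X : ∀ x : M, TangentSpace (𝓡 (n + 1)) x, SmoothField X →
    ∀ x, L.flat x (X x) (L.nablaEnd S X X x) = 0

/-- `lam 0, …, lam k` are the eigenfunctions of `S`: smooth functions whose values at each point
are distinct and are precisely the eigenvalues of `S` there (in particular the number of distinct
eigenvalues is constant), numbered so that the eigenspace distribution of `lam 0` is `Rad TM`. -/
structure IsEigenfunctions
    (S : ∀ x : M, TangentSpace (𝓡 (n + 1)) x →L[ℝ] TangentSpace (𝓡 (n + 1)) x)
    {k : ℕ} (lam : Fin (k + 1) → M → ℝ) : Prop where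
  smooth : ∀ α, ContMDiff (𝓡 (n + 1)) 𝓘(ℝ) ∞ (lam α)
  distinct : ∀ x, Function.Injective fun α => lam α x
  eigenvalue_iff : ∀ (x : M) (c : ℝ),
    Module.End.HasEigenvalue (S x).toLinearMap c ↔ ∃ α, c = lam α x
  eigen_zero : ∀ x, eigenDistribution S (lam 0) x = L.rad x

end LightlikeHypersurface

end NullGeometry

/-! ### Well-posedness: the objects selected above by their defining properties exist and are
unique -/

namespace NullGeometry

theorem representing_spec {T : Type*} [AddCommGroup T] [Module ℝ T] [FiniteDimensional ℝ T]
    (B : T →ₗ[ℝ] T →ₗ[ℝ] ℝ) (hB : ∀ v, (∀ w, B v w = 0) → v = 0) (θ : T →ₗ[ℝ] ℝ) (w : T) :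
    B (representing (fun v w => B v w) θ) w = θ w := by
  have hinj : Function.Injective B := by
    rw [← LinearMap.ker_eq_bot, LinearMap.ker_eq_bot']
    intro m hm
    exact hB m fun w => by rw [hm]; rfl
  have hsurj : Function.Surjective B :=
    (LinearMap.injective_iff_surjective_of_finrank_eq_finrank
      (Subspace.dual_finrank_eq (K := ℝ) (V := T)).symm).1 hinj
  obtain ⟨z, hz⟩ := hsurj θ
  have := Classical.epsilon_spec (p := fun z => ∀ w, B z w = θ w) ⟨z, fun w => by rw [hz]⟩
  exact this w

namespace LorentzMetric

variable {n : ℕ} {N : Type*} [TopologicalSpace N]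
  [ChartedSpace (EuclideanSpace ℝ (Fin (n + 2))) N] [IsManifold (𝓡 (n + 2)) ∞ N]

theorem nondegenerate (g : LorentzMetric n N) (x : N) (v : TangentSpace (𝓡 (n + 2)) x)
    (hv : ∀ w, g.val x v w = 0) : v = 0 := by
  obtain ⟨b, hb⟩ := g.lorentzian x
  rw [← b.forall_coord_eq_zero_iff]
  intro j
  have h := hv (b j)
  rw [← b.sum_repr v] at h
  simp only [map_sum, map_smul, sum_apply, smul_apply, hb] at h
  simp only [smul_eq_mul, mul_ite, mul_zero, Finset.sum_ite_eq', Finset.mem_univ, if_true] at h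
  split_ifs at h <;> simpa using h

end LorentzMetric

namespace LightlikeHypersurface

variable {n : ℕ} {N : Type*} [TopologicalSpace N]
  [ChartedSpace (EuclideanSpace ℝ (Fin (n + 2))) N] [IsManifold (𝓡 (n + 2)) ∞ N]
  {M : Type*} [TopologicalSpace M]
  [ChartedSpace (EuclideanSpace ℝ (Fin (n + 1))) M] [IsManifold (𝓡 (n + 1)) ∞ M]
  (L : LightlikeHypersurface n N M)

theorem gbar_ξ (x : M) (w : TangentSpace (𝓡 (n + 1)) x) :
    L.gbar.val (L.i x) (L.di x (L.ξ x)) (L.di x w) = 0 := by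
  have h : L.ξ x ∈ radical L.gbar L.i x := by
    rw [L.radical_eq x]; exact Submodule.mem_span_singleton_self _
  exact h w

theorem exists_isTransversal (x : M) : ∃ u, L.IsTransversal x u := by
  have hξ : L.ξ x ∈ radical L.gbar L.i x := by
    rw [L.radical_eq x]; exact Submodule.mem_span_singleton_self _
  have hnot : L.di x (L.ξ x) ∉ (L.screen x).map (L.di x).toLinearMap := by
    rintro ⟨w, hw, hwe⟩
    have : w = L.ξ x := L.injective_mfderiv x hwe
    subst this
    exact L.ξ_ne_zero x ((Submodule.disjoint_def.1 (L.isCompl_screen x).disjoint) _ hw hξ)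
  obtain ⟨f, hf1, hf2⟩ := Submodule.exists_le_ker_of_notMem hnot
  have : FiniteDimensional ℝ (TangentSpace (𝓡 (n + 2)) (L.i x)) :=
    inferInstanceAs (FiniteDimensional ℝ (EuclideanSpace ℝ (Fin (n + 2))))
  let B : TangentSpace (𝓡 (n + 2)) (L.i x) →ₗ[ℝ] TangentSpace (𝓡 (n + 2)) (L.i x) →ₗ[ℝ] ℝ :=
    (ContinuousLinearMap.coeLM ℝ).comp (L.gbar.val (L.i x)).toLinearMap
  have hr := representing_spec B (fun v hv => L.gbar.nondegenerate _ v hv) f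
  set u := representing (fun v w => B v w) f
  set e := L.di x (L.ξ x) with he
  have hr' : ∀ w, L.gbar.val (L.i x) u w = f w := hr
  have hee : L.gbar.val (L.i x) e e = 0 := L.gbar_ξ x _
  refine ⟨(f e)⁻¹ • u - (((f e)⁻¹ ^ 2 * L.gbar.val (L.i x) u u) / 2) • e, ?_, ?_, ?_⟩
  · simp only [map_sub, map_smul, sub_apply, smul_apply, hr', ← he, hee, smul_eq_mul]
    field_simp; ring
  · simp only [map_sub, map_smul, sub_apply, smul_apply, hee, smul_eq_mul,
      L.gbar.symm _ e u]
    simp only [hr']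
    field_simp; ring
  · intro w hw
    simp only [map_sub, map_smul, sub_apply, smul_apply, hr', smul_eq_mul]
    have h1 : f (L.di x w) = 0 := hf2 ⟨w, hw, rfl⟩
    rw [h1, L.gbar_ξ]; ring

theorem transversal_spec (x : M) : L.IsTransversal x (L.transversal x) :=
  Classical.epsilon_spec (L.exists_isTransversal x)

theorem isCompl_tangent_transversal (x : M) :
    IsCompl (LinearMap.range (L.di x).toLinearMap) (Submodule.span ℝ {L.transversal x}) := by
  have hN := (L.transversal_spec x).1
  have hne : L.transversal x ≠ 0 := by
    intro h; rw [h] at hN; simp at hN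
  have : FiniteDimensional ℝ (TangentSpace (𝓡 (n + 2)) (L.i x)) :=
    inferInstanceAs (FiniteDimensional ℝ (EuclideanSpace ℝ (Fin (n + 2))))
  have hdisj : Disjoint (LinearMap.range (L.di x).toLinearMap)
      (Submodule.span ℝ {L.transversal x}) := by
    rw [Submodule.disjoint_def]
    rintro _ ⟨v, rfl⟩ h
    obtain ⟨c, hc⟩ := Submodule.mem_span_singleton.1 h
    have h0 := L.gbar_ξ x v
    change _ = L.di x v at hc
    rw [← hc, map_smul, L.gbar.symm, hN] at h0
    have : c = 0 := by simpa using h0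
    change L.di x v = 0
    rw [← hc, this, zero_smul]
  refine ⟨hdisj, ?_⟩
  rw [codisjoint_iff]
  apply Submodule.eq_top_of_disjoint _ _ _ hdisj
  have hinj : Function.Injective (L.di x).toLinearMap := L.injective_mfderiv x
  rw [LinearMap.finrank_range_of_inj hinj, finrank_span_singleton hne]
  have h1 : Module.finrank ℝ (TangentSpace (𝓡 (n + 2)) (L.i x)) = n + 2 :=
    finrank_euclideanSpace_fin
  have h2 : Module.finrank ℝ (TangentSpace (𝓡 (n + 1)) x) = n + 1 :=
    finrank_euclideanSpace_fin
  omega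

theorem isTransversal_unique (x : M) {u v : TangentSpace (𝓡 (n + 2)) (L.i x)}
    (hu : L.IsTransversal x u) (hv : L.IsTransversal x v) : u = v := by
  obtain ⟨a, ha⟩ : ∃ a, u - v = a := ⟨_, rfl⟩
  have hT : ∀ w, L.gbar.val (L.i x) a (L.di x w) = 0 := by
    intro w
    have hw : w ∈ L.screen x ⊔ radical L.gbar L.i x := by
      rw [(L.isCompl_screen x).sup_eq_top]; trivial
    obtain ⟨s, hs, r, hr, rfl⟩ := Submodule.mem_sup.1 hw
    rw [L.radical_eq] at hr
    obtain ⟨c, rfl⟩ := Submodule.mem_span_singleton.1 hr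
    simp only [← ha, map_add, map_smul, map_sub, sub_apply, hu.1, hv.1, hu.2.2 s hs, hv.2.2 s hs]
    simp
  -- the difference is orthogonal to the hypersurface, hence tangent to it
  have hmem : a ∈ LinearMap.range (L.di x).toLinearMap := by
    have htop := (L.isCompl_tangent_transversal x).sup_eq_top
    have key : ∀ w, L.gbar.val (L.i x)
        (a - L.gbar.val (L.i x) a (L.transversal x) • L.di x (L.ξ x)) w = 0 := by
      intro w
      have hw : w ∈ LinearMap.range (L.di x).toLinearMap ⊔
        Submodule.span ℝ {L.transversal x} := by rw [htop]; trivial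
      obtain ⟨_, ⟨t, rfl⟩, _, hr, rfl⟩ := Submodule.mem_sup.1 hw
      obtain ⟨c, rfl⟩ := Submodule.mem_span_singleton.1 hr
      have h1 := hT t
      have h2 := L.gbar_ξ x t
      have h3 := (L.transversal_spec x).1
      rw [L.gbar.symm] at h3
      simp only [map_add, map_smul, map_sub, sub_apply, smul_apply, h3,
        ContinuousLinearMap.coe_coe, h1, h2, smul_eq_mul]
      ring
    have := L.gbar.nondegenerate _ _ key
    rw [sub_eq_zero] at this
    rw [this]
    exact ⟨L.gbar.val (L.i x) a (L.transversal x) • L.ξ x, by simp⟩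
  obtain ⟨t, ht⟩ := hmem
  have htr : t ∈ radical L.gbar L.i x := by
    intro w
    have := hT w
    rw [← ht] at this
    exact this
  rw [L.radical_eq] at htr
  obtain ⟨c, rfl⟩ := Submodule.mem_span_singleton.1 htr
  have hut : u = v + c • L.di x (L.ξ x) := by
    rw [← sub_eq_iff_eq_add', ha, ← ht]; simp
  have h4 := hu.2.1
  rw [hut] at h4
  simp only [map_add, map_smul, add_apply, smul_apply, hv.1, hv.2.1, L.gbar_ξ,
    L.gbar.symm _ (L.di x (L.ξ x)) v, smul_eq_mul] at h4
  have hc : c = 0 := by linarith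
  rw [hut, hc, zero_smul, add_zero]

theorem Q_spec (x : M) (u : TangentSpace (𝓡 (n + 2)) (L.i x)) :
    u - L.di x (L.Q x u) ∈ Submodule.span ℝ {L.transversal x} := by
  apply Classical.epsilon_spec (p := fun v => u - L.di x v ∈ Submodule.span ℝ {L.transversal x})
  have hu : u ∈ LinearMap.range (L.di x).toLinearMap ⊔ Submodule.span ℝ {L.transversal x} := by
    rw [(L.isCompl_tangent_transversal x).sup_eq_top]; trivial
  obtain ⟨_, ⟨t, rfl⟩, r, hr, rfl⟩ := Submodule.mem_sup.1 hu
  exact ⟨t, by simpa using hr⟩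

theorem flat_nondegenerate (x : M) (v : TangentSpace (𝓡 (n + 1)) x)
    (hv : ∀ w, L.flat x v w = 0) : v = 0 := by
  have hηξ : L.η x (L.ξ x) = 1 := (L.transversal_spec x).1
  have h1 : L.g x v (L.ξ x) = 0 := by
    change L.gbar.val _ (L.di x v) (L.di x (L.ξ x)) = 0
    rw [L.gbar.symm]; exact L.gbar_ξ x v
  have h2 : L.η x v = 0 := by
    have := hv (L.ξ x)
    rw [flat, h1, hηξ] at this
    linarith
  have hr : v ∈ radical L.gbar L.i x := by
    intro w
    have := hv w
    rw [flat, h2, zero_mul, add_zero] at this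
    exact this
  rw [L.radical_eq] at hr
  obtain ⟨c, rfl⟩ := Submodule.mem_span_singleton.1 hr
  have : c = 0 := by
    simp only [η, map_smul, smul_eq_mul] at h2
    rw [(L.transversal_spec x).1] at h2
    linarith
  rw [this, zero_smul]

end LightlikeHypersurface
end NullGeometry

end

noncomputable section

namespace NullGeometry

/-! ### Directional derivatives and the Lie bracket. -/

section Manifold

variable {d : ℕ} {M : Type*} [TopologicalSpace M]
  [ChartedSpace (EuclideanSpace ℝ (Fin d)) M]

/-! As `M` is totally geodesic, `di` carries `∇` to the ambient Levi-Civita derivative, so `∇` is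
torsion free and metric for the degenerate `g` (`nabla_sub_nabla`, `dirDeriv_g`). Every tangent
vector is orthogonal to the null vector `ξ`, so `g` is positive semidefinite, and `g̃ = g + η ⊗ η`
is positive definite. `S` is self-adjoint for `g̃`; hence `TM` is the `g`-orthogonal sum of the
`D_α`, and `D_α` lies in the screen for `α ≠ 0`.

Write `T(X, Y, Z) = g(∇_X Y, Z)`. The eigenfunctions are constant along the screen, so for `X` in
the screen, `Y ∈ D_β` and `Z ∈ D_γ` one has `g((∇_X S)Y, Z) = (λ_β - λ_γ) T(X, Y, Z)`
(`g_nablaEnd`). It remains to show `T(X, Y, Z) = 0` for `X ∈ D_α` and `β ≠ γ`, all indices nonzero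
(`g_nabla_eq_zero`).

If `α = β`, the `𝒜^∇` identity at `X + Z` yields `T(X, X, Z) = T(Z, Z, X)`. The sides have opposite
parity in `Z`, so both vanish; polarization and integrability of `D_α` then give `T(X, Y, Z) = 0`.
The case `α = γ` follows from this because `∇` is metric. If the three indices are distinct, `T` is
symmetric in its first two slots by integrability of the pairwise sums and skew in its last two
because `∇` is metric, hence zero.

So `(∇_X S)Y` is `g`-orthogonal to everything. Vanishing of `C` keeps it in the screen, where `g` is
definite. -/

theorem dirDeriv_comp {E F : Type*} [NormedAddCommGroup E] [NormedSpace ℝ E]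
    [NormedAddCommGroup F] [NormedSpace ℝ F] {h : E → F} {f : M → E} {x : M}
    (hh : DifferentiableAt ℝ h (f x)) (hf : MDifferentiableAt (𝓡 d) 𝓘(ℝ, E) f x)
    (v : TangentSpace (𝓡 d) x) :
    dirDeriv (fun y => h (f y)) x v = fderiv ℝ h (f x) (dirDeriv f x v) := by
  unfold dirDeriv
  have := mfderiv_comp x hh.mdifferentiableAt hf
  rw [mfderiv_eq_fderiv] at this
  exact congrArg (fun T => T v) this

theorem dirDeriv_congr {F : Type*} [NormedAddCommGroup F] [NormedSpace ℝ F] {f g : M → F} {x : M}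
    (h : f =ᶠ[𝓝 x] g) (v : TangentSpace (𝓡 d) x) : dirDeriv f x v = dirDeriv g x v := by
  unfold dirDeriv
  have := h.mfderiv_eq (I := 𝓡 d) (I' := 𝓘(ℝ, F))
  exact congrArg (fun T : EuclideanSpace ℝ (Fin d) →L[ℝ] F => T v) this

theorem dirDeriv_add_dir {F : Type*} [NormedAddCommGroup F] [NormedSpace ℝ F] (f : M → F) (x : M)
    (v w : TangentSpace (𝓡 d) x) : dirDeriv f x (v + w) = dirDeriv f x v + dirDeriv f x w :=
  (show EuclideanSpace ℝ (Fin d) →L[ℝ] F from mfderiv (𝓡 d) 𝓘(ℝ, F) f x).map_add v w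

theorem dirDeriv_smul_dir {F : Type*} [NormedAddCommGroup F] [NormedSpace ℝ F] (f : M → F) (x : M)
    (c : ℝ) (v : TangentSpace (𝓡 d) x) : dirDeriv f x (c • v) = c • dirDeriv f x v :=
  (show EuclideanSpace ℝ (Fin d) →L[ℝ] F from mfderiv (𝓡 d) 𝓘(ℝ, F) f x).map_smul c v

/-- Reduces each product rule below to the chain rule for a map on a product of normed spaces; the
components come from the chain rule for the two projections. -/
theorem dirDeriv_prodMk {E F : Type*} [NormedAddCommGroup E] [NormedSpace ℝ E]
    [NormedAddCommGroup F] [NormedSpace ℝ F] {f : M → E} {h : M → F} {x : M}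
    (hf : MDifferentiableAt (𝓡 d) 𝓘(ℝ, E) f x) (hh : MDifferentiableAt (𝓡 d) 𝓘(ℝ, F) h x)
    (v : TangentSpace (𝓡 d) x) :
    dirDeriv (fun y => (f y, h y)) x v = (dirDeriv f x v, dirDeriv h x v) := by
  have h1 := dirDeriv_comp (h := (Prod.fst : E × F → E)) differentiableAt_fst
    (hf.prodMk_space hh) v
  have h2 := dirDeriv_comp (h := (Prod.snd : E × F → F)) differentiableAt_snd
    (hf.prodMk_space hh) v
  rw [fderiv_fst] at h1
  rw [fderiv_snd] at h2
  exact Prod.ext h1.symm h2.symm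

theorem dirDeriv_add {F : Type*} [NormedAddCommGroup F] [NormedSpace ℝ F] {a b : M → F} {x : M}
    (ha : MDifferentiableAt (𝓡 d) 𝓘(ℝ, F) a x) (hb : MDifferentiableAt (𝓡 d) 𝓘(ℝ, F) b x)
    (v : TangentSpace (𝓡 d) x) :
    dirDeriv (fun y => a y + b y) x v = dirDeriv a x v + dirDeriv b x v := by
  rw [dirDeriv_comp (h := fun p : F × F => p.1 + p.2) (by fun_prop) (ha.prodMk_space hb),
    dirDeriv_prodMk ha hb, fderiv_fun_add (by fun_prop) (by fun_prop), fderiv_fst, fderiv_snd]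
  rfl

theorem dirDeriv_smul {F : Type*} [NormedAddCommGroup F] [NormedSpace ℝ F] {f : M → ℝ} {a : M → F}
    {x : M} (hf : MDifferentiableAt (𝓡 d) 𝓘(ℝ) f x) (ha : MDifferentiableAt (𝓡 d) 𝓘(ℝ, F) a x)
    (v : TangentSpace (𝓡 d) x) :
    dirDeriv (fun y => f y • a y) x v = dirDeriv f x v • a x + f x • dirDeriv a x v := by
  rw [dirDeriv_comp (h := fun p : ℝ × F => p.1 • p.2) (by fun_prop) (hf.prodMk_space ha),
    dirDeriv_prodMk hf ha, fderiv_fun_smul (by fun_prop) (by fun_prop), fderiv_fst, fderiv_snd]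
  simp [add_comm]

theorem dirDeriv_clm_apply {E F : Type*} [NormedAddCommGroup E] [NormedSpace ℝ E]
    [NormedAddCommGroup F] [NormedSpace ℝ F] {G : M → E →L[ℝ] F} {a : M → E} {x : M}
    (hG : MDifferentiableAt (𝓡 d) 𝓘(ℝ, E →L[ℝ] F) G x)
    (ha : MDifferentiableAt (𝓡 d) 𝓘(ℝ, E) a x) (v : TangentSpace (𝓡 d) x) :
    dirDeriv (fun y => G y (a y)) x v = dirDeriv G x v (a x) + G x (dirDeriv a x v) := by
  rw [dirDeriv_comp (h := fun p : (E →L[ℝ] F) × E => p.1 p.2) (by fun_prop)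
    (hG.prodMk_space ha), dirDeriv_prodMk hG ha, fderiv_clm_apply (by fun_prop) (by fun_prop),
    fderiv_fst, fderiv_snd]
  simp [add_comm]

theorem dirDeriv_clm_apply₂ {E F : Type*} [NormedAddCommGroup E] [NormedSpace ℝ E]
    [NormedAddCommGroup F] [NormedSpace ℝ F] {G : M → E →L[ℝ] E →L[ℝ] F} {a b : M → E} {x : M}
    (hG : MDifferentiableAt (𝓡 d) 𝓘(ℝ, E →L[ℝ] E →L[ℝ] F) G x)
    (ha : MDifferentiableAt (𝓡 d) 𝓘(ℝ, E) a x) (hb : MDifferentiableAt (𝓡 d) 𝓘(ℝ, E) b x)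
    (v : TangentSpace (𝓡 d) x) :
    dirDeriv (fun y => G y (a y) (b y)) x v = dirDeriv G x v (a x) (b x)
      + G x (dirDeriv a x v) (b x) + G x (a x) (dirDeriv b x v) := by
  rw [dirDeriv_clm_apply (hG.clm_apply ha) hb, dirDeriv_clm_apply hG ha, add_apply]

theorem dirDeriv_const {F : Type*} [NormedAddCommGroup F] [NormedSpace ℝ F] (c : F) (x : M)
    (v : TangentSpace (𝓡 d) x) : dirDeriv (fun _ : M => c) x v = 0 := by
  unfold dirDeriv
  rw [mfderiv_const]
  rfl

variable [IsManifold (𝓡 d) ∞ M]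

theorem coordField_comp {q y : M} (hy : y ∈ (chartAt (EuclideanSpace ℝ (Fin d)) q).source)
    (u : TangentSpace (𝓡 d) y) : coordField q (comp q y u) y = u :=
  (trivializationAt (EuclideanSpace ℝ (Fin d)) (TangentSpace (𝓡 d)) q).symmL_continuousLinearMapAt
    (R := ℝ) (by simpa using hy) u

theorem comp_eq_mfderiv {q y : M} (hy : y ∈ (chartAt (EuclideanSpace ℝ (Fin d)) q).source)
    (u : TangentSpace (𝓡 d) y) :
    comp q y u = mfderiv (𝓡 d) 𝓘(ℝ, EuclideanSpace ℝ (Fin d)) (extChartAt (𝓡 d) q) y u := by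
  unfold comp
  rw [TangentBundle.continuousLinearMapAt_trivializationAt hy]
  rfl

/-- The inverse of the differential of the inverse chart. -/
theorem mfderivWithin_extChartAt_symm_inverse {x y : M} (hy : y ∈ (extChartAt (𝓡 d) x).source) :
    (mfderivWithin 𝓘(ℝ, EuclideanSpace ℝ (Fin d)) (𝓡 d) (extChartAt (𝓡 d) x).symm
      (Set.range (𝓡 d)) (extChartAt (𝓡 d) x y)).inverse =
      mfderiv (𝓡 d) 𝓘(ℝ, EuclideanSpace ℝ (Fin d)) (extChartAt (𝓡 d) x)
        ((extChartAt (𝓡 d) x).symm (extChartAt (𝓡 d) x y)) := by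
  have hy' := (extChartAt (𝓡 d) x).map_source hy
  apply ContinuousLinearMap.inverse_eq
  · exact mfderivWithin_extChartAt_symm_comp_mfderiv_extChartAt hy'
  · exact mfderiv_extChartAt_comp_mfderivWithin_extChartAt_symm hy'

/-- The commutator of derivatives along two vector fields is the derivative along their bracket. -/
theorem dirDeriv_mfderiv_sub_dirDeriv_mfderiv {F : Type*} [NormedAddCommGroup F] [NormedSpace ℝ F]
    {f : M → F} {x : M} (hf : ContMDiffAt (𝓡 d) 𝓘(ℝ, F) ∞ f x)
    {X Y : ∀ x : M, TangentSpace (𝓡 d) x} (hX : SmoothField X) (hY : SmoothField Y) :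
    dirDeriv (fun y => (mfderiv (𝓡 d) 𝓘(ℝ, F) f y (Y y) : F)) x (X x)
      - dirDeriv (fun y => (mfderiv (𝓡 d) 𝓘(ℝ, F) f y (X y) : F)) x (Y x)
      = mfderiv (𝓡 d) 𝓘(ℝ, F) f x (VectorField.mlieBracket (𝓡 d) X Y x) := by
  set φ := extChartAt (𝓡 d) x with hφ
  set h : EuclideanSpace ℝ (Fin d) → F := fun e => f (φ.symm e) with hh
  let V' (V : ∀ x : M, TangentSpace (𝓡 d) x) :
      EuclideanSpace ℝ (Fin d) → EuclideanSpace ℝ (Fin d) :=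
    VectorField.mpullbackWithin 𝓘(ℝ, EuclideanSpace ℝ (Fin d)) (𝓡 d) φ.symm V (Set.range (𝓡 d))
  have hx : x ∈ φ.source := mem_extChartAt_source x
  have hhsm : ContDiffAt ℝ ∞ h (φ x) := by
    rw [← contMDiffAt_iff_contDiffAt]
    have h1 := contMDiffWithinAt_extChartAt_symm_range (I := 𝓡 d) (n := ∞) x
      (mem_extChartAt_target x)
    rw [ModelWithCorners.Boundaryless.range_eq_univ, contMDiffWithinAt_univ] at h1
    exact ContMDiffAt.comp_of_eq (hf) h1 (extChartAt_to_inv x)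
  have hφd : ∀ y ∈ φ.source, MDifferentiableAt (𝓡 d) 𝓘(ℝ, EuclideanSpace ℝ (Fin d)) φ y :=
    fun y hy => mdifferentiableAt_extChartAt (by simpa [hφ] using hy)
  -- The pullback by the inverse chart is the pushforward by the chart.
  have hV' : ∀ (V : ∀ x : M, TangentSpace (𝓡 d) x), ∀ y ∈ φ.source,
      V' V (φ y) = dirDeriv (φ : M → EuclideanSpace ℝ (Fin d)) y (V y) := by
    intro V y hy
    change (mfderivWithin _ _ _ _ _).inverse (V (φ.symm (φ y))) = _
    rw [mfderivWithin_extChartAt_symm_inverse hy]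
    unfold dirDeriv
    rw [φ.left_inv hy]
  have hsrc : ∀ᶠ y in 𝓝 x, y ∈ φ.source := extChartAt_source_mem_nhds x
  have hcont : ContinuousAt φ x := continuousAt_extChartAt x
  -- Differentiability is needed near the point, and only a finite order spreads to a neighbourhood.
  have hev : ∀ᶠ e in 𝓝 (φ x), ContDiffAt ℝ 1 h e :=
    (hhsm.of_le (by norm_cast)).eventually (by simp)
  have hfh : ∀ᶠ y in 𝓝 x, ∀ v : TangentSpace (𝓡 d) y,
      dirDeriv f y v = fderiv ℝ h (φ y) (dirDeriv (φ : M → _) y v) := by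
    filter_upwards [hcont.eventually hev, eventually_eventually_nhds.2 hsrc] with y h1 h2 v
    rw [← dirDeriv_comp (h1.differentiableAt (by simp)) (hφd y h2.self_of_nhds)]
    apply dirDeriv_congr
    filter_upwards [h2] with z hz
    rw [hh]; simp only [φ.left_inv hz]
  have hset : φ.symm ⁻¹' Set.univ ∩ Set.range (𝓡 d) = Set.univ := by simp
  have hVd : ∀ (V : ∀ x : M, TangentSpace (𝓡 d) x), SmoothField V →
      DifferentiableAt ℝ (V' V) (φ x) := by
    intro V hV
    have h1 : DifferentiableWithinAt ℝ (V' V) (φ.symm ⁻¹' Set.univ ∩ Set.range (𝓡 d)) (φ x) :=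
      MDifferentiableWithinAt.differentiableWithinAt_mpullbackWithin_vectorField
        ((hV.contMDiffAt (x := x)).mdifferentiableAt (by simp)).mdifferentiableWithinAt
    rwa [hset, differentiableWithinAt_univ] at h1
  have hd2 : DifferentiableAt ℝ (fderiv ℝ h) (φ x) :=
    (hhsm.fderiv_right (m := 1) (by norm_cast)).differentiableAt (by simp)
  -- A Hessian term plus a derivative of the field: the Hessian terms cancel by symmetry, and what
  -- is left is the bracket in the chart.
  have key : ∀ (V W : ∀ x : M, TangentSpace (𝓡 d) x), SmoothField V → SmoothField W →
      dirDeriv (fun y => (mfderiv (𝓡 d) 𝓘(ℝ, F) f y (W y) : F)) x (V x) =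
        fderiv ℝ (fderiv ℝ h) (φ x) (V' V (φ x)) (V' W (φ x))
          + fderiv ℝ h (φ x) (fderiv ℝ (V' W) (φ x) (V' V (φ x))) := by
    intro V W hV hW
    have h1 : (fun y => (mfderiv (𝓡 d) 𝓘(ℝ, F) f y (W y) : F)) =ᶠ[𝓝 x]
        fun y => (fun e => fderiv ℝ h e (V' W e)) (φ y) := by
      filter_upwards [hfh, hsrc] with y hy hys
      rw [hV' W y hys]
      exact hy _
    rw [dirDeriv_congr h1, dirDeriv_comp (hd2.clm_apply (hVd W hW)) (hφd x hx), ← hV' V x hx,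
      fderiv_clm_apply hd2 (hVd W hW)]
    simp [add_comm]
  have hsymm : IsSymmSndFDerivAt ℝ h (φ x) := hhsm.isSymmSndFDerivAt (by simp; norm_cast)
  rw [key X Y hX hY, key Y X hY hX, hsymm.eq (V' X (φ x)), add_sub_add_left_eq_sub, ← map_sub]
  refine Eq.trans ?_ (hfh.self_of_nhds _).symm
  congr 1
  have hbr : VectorField.mlieBracket (𝓡 d) X Y x =
      (mfderiv (𝓡 d) 𝓘(ℝ, EuclideanSpace ℝ (Fin d)) φ x).inverse
        (VectorField.lieBracketWithin ℝ (V' X) (V' Y)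
          (φ.symm ⁻¹' Set.univ ∩ Set.range (𝓡 d)) (φ x)) := rfl
  have hlb : VectorField.lieBracketWithin ℝ (V' X) (V' Y)
      (φ.symm ⁻¹' Set.univ ∩ Set.range (𝓡 d)) (φ x) =
        fderiv ℝ (V' Y) (φ x) (V' X (φ x)) - fderiv ℝ (V' X) (φ x) (V' Y (φ x)) := by
    rw [hset, VectorField.lieBracketWithin_univ]
    rfl
  rw [hbr]
  exact (((isInvertible_mfderiv_extChartAt hx).self_apply_inverse _).trans hlb).symm

end Manifold
end NullGeometry

namespace NullGeometry

/-! ### Christoffel symbols and the Levi-Civita derivative along a map. -/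

section Manifold

variable {d : ℕ} {M : Type*} [TopologicalSpace M]
  [ChartedSpace (EuclideanSpace ℝ (Fin d)) M] [IsManifold (𝓡 d) ∞ M]

/-- The pullback of a bilinear form at `y` to the model space by the coordinate frame of the
preferred chart at `q`. -/
def bilinCoord (q y : M) (B : TangentSpace (𝓡 d) y →L[ℝ] TangentSpace (𝓡 d) y →L[ℝ] ℝ) :
    EuclideanSpace ℝ (Fin d) →L[ℝ] EuclideanSpace ℝ (Fin d) →L[ℝ] ℝ :=
  let e := (trivializationAt (EuclideanSpace ℝ (Fin d)) (TangentSpace (𝓡 d)) q).symmL ℝ y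
  (ContinuousLinearMap.precomp ℝ e).comp (B.comp e)

theorem bilinCoord_apply (q y : M)
    (B : TangentSpace (𝓡 d) y →L[ℝ] TangentSpace (𝓡 d) y →L[ℝ] ℝ)
    (a b : EuclideanSpace ℝ (Fin d)) :
    bilinCoord q y B a b = B (coordField q a y) (coordField q b y) := rfl

theorem contMDiffAt_bilinCoord
    {B : ∀ y : M, TangentSpace (𝓡 d) y →L[ℝ] TangentSpace (𝓡 d) y →L[ℝ] ℝ}
    (hB : ContMDiff (𝓡 d) ((𝓡 d).prod
      𝓘(ℝ, EuclideanSpace ℝ (Fin d) →L[ℝ] EuclideanSpace ℝ (Fin d) →L[ℝ] ℝ)) ∞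
    (fun x => TotalSpace.mk'
      (EuclideanSpace ℝ (Fin d) →L[ℝ] EuclideanSpace ℝ (Fin d) →L[ℝ] ℝ)
      (E := fun x : M =>
        TangentSpace (𝓡 d) x →L[ℝ] TangentSpace (𝓡 d) x →L[ℝ] ℝ) x (B x))) (q : M) :
    ContMDiffAt (𝓡 d) 𝓘(ℝ, EuclideanSpace ℝ (Fin d) →L[ℝ] EuclideanSpace ℝ (Fin d) →L[ℝ] ℝ) ∞
      (fun y => bilinCoord q y (B y)) q := by
  have h := ((contMDiffAt_hom_bundle _).1 (hB.contMDiffAt (x := q))).2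
  refine h.congr_of_eventuallyEq ?_
  filter_upwards [chart_source_mem_nhds (EuclideanSpace ℝ (Fin d)) q] with y hy
  ext a b
  rw [bilinCoord_apply]
  have h2 : y ∈ (trivializationAt (EuclideanSpace ℝ (Fin d) →L[ℝ] ℝ)
    (fun x : M => TangentSpace (𝓡 d) x →L[ℝ] ℝ) q).baseSet := by
    simpa [hom_trivializationAt_baseSet] using hy
  rw [ContinuousLinearMap.inCoordinates_eq (by simpa using hy) h2]
  unfold coordField
  simp [hom_trivializationAt_apply, ContinuousLinearMap.inCoordinates,
    (trivializationAt (EuclideanSpace ℝ (Fin d)) (TangentSpace (𝓡 d)) q).symmL_apply (R := ℝ)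
      (show y ∈ _ by simpa using hy)]

end Manifold

section LeviCivita

variable {n : ℕ} {N : Type*} [TopologicalSpace N]
  [ChartedSpace (EuclideanSpace ℝ (Fin (n + 2))) N] [IsManifold (𝓡 (n + 2)) ∞ N]
  {M : Type*} [TopologicalSpace M]
  [ChartedSpace (EuclideanSpace ℝ (Fin (n + 1))) M]

/-- The derivative at `q` of the coefficients of the metric in the preferred chart at `q`. -/
def metricDeriv (g : LorentzMetric n N) (q : N) (u : TangentSpace (𝓡 (n + 2)) q) :
    EuclideanSpace ℝ (Fin (n + 2)) →L[ℝ] EuclideanSpace ℝ (Fin (n + 2)) →L[ℝ] ℝ :=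
  dirDeriv (fun y => bilinCoord q y (g.val y)) q u

theorem metricDeriv_add (g : LorentzMetric n N) (q : N) (u v : TangentSpace (𝓡 (n + 2)) q) :
    metricDeriv g q (u + v) = metricDeriv g q u + metricDeriv g q v :=
  dirDeriv_add_dir _ q u v

theorem metricDeriv_smul (g : LorentzMetric n N) (q : N) (c : ℝ)
    (u : TangentSpace (𝓡 (n + 2)) q) :
    metricDeriv g q (c • u) = c • metricDeriv g q u :=
  dirDeriv_smul_dir _ q c u

theorem mdifferentiableAt_bilinCoord (g : LorentzMetric n N) (q : N) :
    MDifferentiableAt (𝓡 (n + 2)) 𝓘(ℝ, EuclideanSpace ℝ (Fin (n + 2)) →L[ℝ]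
      EuclideanSpace ℝ (Fin (n + 2)) →L[ℝ] ℝ) (fun y => bilinCoord q y (g.val y)) q :=
  (contMDiffAt_bilinCoord g.contMDiff q).mdifferentiableAt (by simp)

theorem dirDeriv_coordField (g : LorentzMetric n N) (q : N) (u : TangentSpace (𝓡 (n + 2)) q)
    (a b : EuclideanSpace ℝ (Fin (n + 2))) :
    dirDeriv (fun y => g.val y (coordField q a y) (coordField q b y)) q u =
      metricDeriv g q u a b := by
  have h := dirDeriv_clm_apply₂ (mdifferentiableAt_bilinCoord g q) (mdifferentiableAt_const (c := a))
    (mdifferentiableAt_const (c := b)) u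
  rw [dirDeriv_const, dirDeriv_const, map_zero, map_zero, zero_apply, add_zero, add_zero] at h
  exact h

theorem metricDeriv_symm (g : LorentzMetric n N) (q : N) (u : TangentSpace (𝓡 (n + 2)) q)
    (a b : EuclideanSpace ℝ (Fin (n + 2))) : metricDeriv g q u a b = metricDeriv g q u b a := by
  rw [← dirDeriv_coordField, ← dirDeriv_coordField]
  simp_rw [g.symm _ (coordField q a _)]

theorem comp_add (q y : N) (u v : TangentSpace (𝓡 (n + 2)) y) :
    comp q y (u + v) = comp q y u + comp q y v := map_add _ u v

theorem comp_smul (q y : N) (c : ℝ) (u : TangentSpace (𝓡 (n + 2)) y) :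
    comp q y (c • u) = c • comp q y u := map_smul _ c u

theorem coordField_add (q y : N) (u v : EuclideanSpace ℝ (Fin (n + 2))) :
    coordField q (u + v) y = coordField q u y + coordField q v y := map_add _ u v

theorem coordField_sub (q y : N) (u v : EuclideanSpace ℝ (Fin (n + 2))) :
    coordField q (u - v) y = coordField q u y - coordField q v y := map_sub _ u v

theorem coordField_smul (q y : N) (c : ℝ) (u : EuclideanSpace ℝ (Fin (n + 2))) :
    coordField q (c • u) y = c • coordField q u y := map_smul _ c u

/-- The Koszul expression is linear in `w` and `g` is nondegenerate, so the chosen representing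
vector exists. Later algebra of `christoffel` is done by pairing with `w`. -/
theorem val_christoffel (g : LorentzMetric n N) (q : N) (u v w : TangentSpace (𝓡 (n + 2)) q) :
    g.val q (christoffel g q u v) w =
      (metricDeriv g q u (comp q q v) (comp q q w) + metricDeriv g q v (comp q q u) (comp q q w)
        - metricDeriv g q w (comp q q u) (comp q q v)) / 2 := by
  have : FiniteDimensional ℝ (TangentSpace (𝓡 (n + 2)) q) :=
    inferInstanceAs (FiniteDimensional ℝ (EuclideanSpace ℝ (Fin (n + 2))))
  let B : TangentSpace (𝓡 (n + 2)) q →ₗ[ℝ] TangentSpace (𝓡 (n + 2)) q →ₗ[ℝ] ℝ :=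
    (ContinuousLinearMap.coeLM ℝ).comp (g.val q).toLinearMap
  let θ : TangentSpace (𝓡 (n + 2)) q →ₗ[ℝ] ℝ :=
    { toFun := fun w => (metricDeriv g q u (comp q q v) (comp q q w)
        + metricDeriv g q v (comp q q u) (comp q q w)
        - metricDeriv g q w (comp q q u) (comp q q v)) / 2
      map_add' := by
        intro w w'
        simp only [comp_add, metricDeriv_add, map_add, add_apply]
        ring
      map_smul' := by
        intro c w
        simp only [comp_smul, metricDeriv_smul, map_smul, smul_apply, smul_eq_mul,
          RingHom.id_apply]
        ring }
  have h := representing_spec B (fun v hv => g.nondegenerate q v hv) θ w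
  unfold christoffel
  simp only [dirDeriv_coordField]
  exact h

theorem LorentzMetric.ext_val (g : LorentzMetric n N) {q : N} {u v : TangentSpace (𝓡 (n + 2)) q}
    (h : ∀ w, g.val q u w = g.val q v w) : u = v := by
  rw [← sub_eq_zero]
  apply g.nondegenerate
  intro w
  rw [map_sub, sub_apply, h w, sub_self]

theorem christoffel_symm (g : LorentzMetric n N) (q : N) (u v : TangentSpace (𝓡 (n + 2)) q) :
    christoffel g q u v = christoffel g q v u := by
  apply g.ext_val
  intro w
  rw [val_christoffel, val_christoffel, metricDeriv_symm g q w]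
  ring

theorem christoffel_add (g : LorentzMetric n N) (q : N) (u v v' : TangentSpace (𝓡 (n + 2)) q) :
    christoffel g q u (v + v') = christoffel g q u v + christoffel g q u v' := by
  apply g.ext_val
  intro w
  simp only [map_add, add_apply, val_christoffel, comp_add, metricDeriv_add]
  ring

theorem christoffel_smul (g : LorentzMetric n N) (q : N) (c : ℝ)
    (u v : TangentSpace (𝓡 (n + 2)) q) :
    christoffel g q u (c • v) = c • christoffel g q u v := by
  apply g.ext_val
  intro w
  simp only [map_smul, smul_apply, val_christoffel, comp_smul, metricDeriv_smul, smul_eq_mul]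
  ring

/-- Exchanging `v` and `w` in the Koszul expression flips the last two derivatives and doubles the
one along `u`: metric compatibility at a point. -/
theorem val_christoffel_add_val_christoffel (g : LorentzMetric n N) (q : N)
    (u v w : TangentSpace (𝓡 (n + 2)) q) :
    g.val q (christoffel g q u v) w + g.val q v (christoffel g q u w) =
      metricDeriv g q u (comp q q v) (comp q q w) := by
  rw [g.symm q v, val_christoffel, val_christoffel, metricDeriv_symm g q u (comp q q w),
    metricDeriv_symm g q v (comp q q u), metricDeriv_symm g q w (comp q q u)]
  ring

section Along

variable (g : LorentzMetric n N) {i : M → N}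

/-- A vector field along `i` is differentiable at `x` if its components are. -/
def DifferentiableAlong (i : M → N) (V : ∀ x : M, TangentSpace (𝓡 (n + 2)) (i x)) (x : M) : Prop :=
  MDifferentiableAt (𝓡 (n + 1)) 𝓘(ℝ, EuclideanSpace ℝ (Fin (n + 2)))
    (fun y => comp (i x) (i y) (V y)) x

theorem leviCivitaAlong_add {V W : ∀ x : M, TangentSpace (𝓡 (n + 2)) (i x)} {x : M}
    (hV : DifferentiableAlong i V x) (hW : DifferentiableAlong i W x)
    (v : TangentSpace (𝓡 (n + 1)) x) :
    leviCivitaAlong g i (fun y => V y + W y) x v =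
      leviCivitaAlong g i V x v + leviCivitaAlong g i W x v := by
  unfold leviCivitaAlong
  simp only [comp_add]
  rw [dirDeriv_add hV hW, coordField_add, christoffel_add]
  abel

theorem leviCivitaAlong_smul {V : ∀ x : M, TangentSpace (𝓡 (n + 2)) (i x)} {f : M → ℝ} {x : M}
    (hf : MDifferentiableAt (𝓡 (n + 1)) 𝓘(ℝ) f x) (hV : DifferentiableAlong i V x)
    (v : TangentSpace (𝓡 (n + 1)) x) :
    leviCivitaAlong g i (fun y => f y • V y) x v =
      dirDeriv f x v • V x + f x • leviCivitaAlong g i V x v := by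
  unfold leviCivitaAlong
  simp only [comp_smul]
  rw [dirDeriv_smul hf hV, coordField_add, christoffel_smul, coordField_smul, coordField_smul,
    coordField_comp (mem_chart_source _ _)]
  module

theorem leviCivitaAlong_add_dir (V : ∀ x : M, TangentSpace (𝓡 (n + 2)) (i x)) (x : M)
    (v w : TangentSpace (𝓡 (n + 1)) x) :
    leviCivitaAlong g i V x (v + w) = leviCivitaAlong g i V x v + leviCivitaAlong g i V x w := by
  unfold leviCivitaAlong
  -- Additivity of `christoffel` is known in the second slot; symmetry moves the direction there.
  rw [dirDeriv_add_dir, map_add, christoffel_symm, christoffel_add, coordField_add]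
  simp only [christoffel_symm _ _ (V x)]
  abel

theorem leviCivitaAlong_smul_dir (V : ∀ x : M, TangentSpace (𝓡 (n + 2)) (i x)) (x : M) (c : ℝ)
    (v : TangentSpace (𝓡 (n + 1)) x) :
    leviCivitaAlong g i V x (c • v) = c • leviCivitaAlong g i V x v := by
  unfold leviCivitaAlong
  rw [dirDeriv_smul_dir, map_smul, christoffel_symm, christoffel_smul, coordField_smul, smul_add,
    christoffel_symm]

/-- The Levi-Civita derivative is compatible with the metric. -/
theorem dirDeriv_val {V W : ∀ x : M, TangentSpace (𝓡 (n + 2)) (i x)} {x : M}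
    (hi : MDifferentiableAt (𝓡 (n + 1)) (𝓡 (n + 2)) i x)
    (hV : DifferentiableAlong i V x) (hW : DifferentiableAlong i W x)
    (v : TangentSpace (𝓡 (n + 1)) x) :
    dirDeriv (fun y => g.val (i y) (V y) (W y)) x v =
      g.val (i x) (leviCivitaAlong g i V x v) (W x)
        + g.val (i x) (V x) (leviCivitaAlong g i W x v) := by
  have hsrc : ∀ᶠ y in 𝓝 x, i y ∈ (chartAt (EuclideanSpace ℝ (Fin (n + 2))) (i x)).source :=
    hi.continuousAt.eventually (chart_source_mem_nhds _ _)
  -- In the frame at `i x` the pairing is a product of three differentiable factors; the derivative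
  -- of the metric coefficients is then absorbed by the Christoffel terms.
  have h1 : (fun y => g.val (i y) (V y) (W y)) =ᶠ[𝓝 x] fun y =>
      bilinCoord (i x) (i y) (g.val (i y)) (comp (i x) (i y) (V y)) (comp (i x) (i y) (W y)) := by
    filter_upwards [hsrc] with y hy
    rw [bilinCoord_apply, coordField_comp hy, coordField_comp hy]
  have hG := mdifferentiableAt_bilinCoord g (i x)
  have h2 : dirDeriv (fun y => bilinCoord (i x) (i y) (g.val (i y))) x v =
      metricDeriv g (i x) (mfderiv (𝓡 (n + 1)) (𝓡 (n + 2)) i x v) := by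
    unfold dirDeriv metricDeriv
    exact congrArg (fun T => T v) (mfderiv_comp x hG hi)
  have hGi : MDifferentiableAt (𝓡 (n + 1)) 𝓘(ℝ, EuclideanSpace ℝ (Fin (n + 2)) →L[ℝ]
      EuclideanSpace ℝ (Fin (n + 2)) →L[ℝ] ℝ) (fun y => bilinCoord (i x) (i y) (g.val (i y))) x :=
    MDifferentiableAt.comp x hG hi
  rw [dirDeriv_congr h1, dirDeriv_clm_apply₂ hGi hV hW, h2,
    ← val_christoffel_add_val_christoffel]
  simp only [bilinCoord_apply, coordField_comp (mem_chart_source _ _)]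
  unfold leviCivitaAlong
  simp only [map_add, add_apply]
  ring

variable [IsManifold (𝓡 (n + 1)) ∞ M]

/-- The Levi-Civita derivative is torsion free. -/
theorem leviCivitaAlong_sub_leviCivitaAlong
    (hi : ContMDiff (𝓡 (n + 1)) (𝓡 (n + 2)) ∞ i)
    {X Y : ∀ x : M, TangentSpace (𝓡 (n + 1)) x} (hX : SmoothField X) (hY : SmoothField Y) (x : M) :
    leviCivitaAlong g i (fun y => mfderiv (𝓡 (n + 1)) (𝓡 (n + 2)) i y (Y y)) x (X x)
      - leviCivitaAlong g i (fun y => mfderiv (𝓡 (n + 1)) (𝓡 (n + 2)) i y (X y)) x (Y x) =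
      mfderiv (𝓡 (n + 1)) (𝓡 (n + 2)) i x (VectorField.mlieBracket (𝓡 (n + 1)) X Y x) := by
  -- Near `x`, the components of `di W` are the derivatives of `f` along `W`, so the commutator
  -- identity for `f` gives the bracket; the Christoffel terms cancel by symmetry.
  set f : M → EuclideanSpace ℝ (Fin (n + 2)) := fun y => extChartAt (𝓡 (n + 2)) (i x) (i y) with hf
  have hsrc : ∀ᶠ y in 𝓝 x, i y ∈ (chartAt (EuclideanSpace ℝ (Fin (n + 2))) (i x)).source :=
    hi.continuous.continuousAt.eventually (chart_source_mem_nhds _ _)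
  have hfs : ContMDiffAt (𝓡 (n + 1)) 𝓘(ℝ, EuclideanSpace ℝ (Fin (n + 2))) ∞ f x :=
    (contMDiffAt_extChartAt (I := 𝓡 (n + 2)) (x := i x)).comp x hi.contMDiffAt
  have hev : ∀ᶠ y in 𝓝 x, ∀ v : TangentSpace (𝓡 (n + 1)) y,
      comp (i x) (i y) (mfderiv (𝓡 (n + 1)) (𝓡 (n + 2)) i y v) =
        mfderiv (𝓡 (n + 1)) 𝓘(ℝ, EuclideanSpace ℝ (Fin (n + 2))) f y v := by
    filter_upwards [hsrc] with y hy v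
    rw [comp_eq_mfderiv hy]
    exact (congrArg (fun T => T v) (mfderiv_comp y (mdifferentiableAt_extChartAt hy)
      (hi.mdifferentiableAt (by simp)))).symm
  have h := dirDeriv_mfderiv_sub_dirDeriv_mfderiv hfs hX hY
  have hc : ∀ (V W : ∀ x : M, TangentSpace (𝓡 (n + 1)) x),
      dirDeriv (fun y => comp (i x) (i y) (mfderiv (𝓡 (n + 1)) (𝓡 (n + 2)) i y (W y))) x (V x) =
      dirDeriv (fun y => (mfderiv (𝓡 (n + 1)) 𝓘(ℝ, EuclideanSpace ℝ (Fin (n + 2))) f y (W y) :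
        EuclideanSpace ℝ (Fin (n + 2)))) x (V x) := by
    intro V W
    apply dirDeriv_congr
    filter_upwards [hev] with y hy
    exact hy _
  unfold leviCivitaAlong
  rw [hc, hc, christoffel_symm g (i x) _ (mfderiv (𝓡 (n + 1)) (𝓡 (n + 2)) i x (X x)),
    add_sub_add_right_eq_sub, ← coordField_sub, h]
  refine (congrArg (fun c => coordField (i x) c (i x)) (hev.self_of_nhds _)).symm.trans ?_
  exact coordField_comp (mem_chart_source _ _) _

/-- The tangent map of `i` composed with a smooth section is smooth, and near `x` the function
`comp` is its fibre coordinate in the trivialization at `i x`. -/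
theorem differentiableAlong_mfderiv
    (hi : ContMDiff (𝓡 (n + 1)) (𝓡 (n + 2)) ∞ i)
    {X : ∀ x : M, TangentSpace (𝓡 (n + 1)) x} (hX : SmoothField X) (x : M) :
    DifferentiableAlong i (fun y => mfderiv (𝓡 (n + 1)) (𝓡 (n + 2)) i y (X y)) x := by
  have h1 : ContMDiff (𝓡 (n + 1)) (𝓡 (n + 2)).tangent ∞
      (fun y => (⟨i y, mfderiv (𝓡 (n + 1)) (𝓡 (n + 2)) i y (X y)⟩ : TangentBundle (𝓡 (n + 2)) N)) :=
    (hi.contMDiff_tangentMap (m := ∞) (by simp)).comp hX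
  have h2 := ((contMDiffAt_totalSpace.1 h1.contMDiffAt).2 : ContMDiffAt _ _ _ _ x)
  refine (h2.mdifferentiableAt (by simp)).congr_of_eventuallyEq ?_
  have hsrc : ∀ᶠ y in 𝓝 x, i y ∈ (chartAt (EuclideanSpace ℝ (Fin (n + 2))) (i x)).source :=
    hi.continuous.continuousAt.eventually (chart_source_mem_nhds _ _)
  filter_upwards [hsrc] with y hy
  unfold comp
  rw [Trivialization.continuousLinearMapAt_apply, Trivialization.linearMapAt_apply,
    if_pos (by simpa using hy)]

end Along

end LeviCivita
end NullGeometry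

namespace NullGeometry

/-! ### Smooth sections, self-adjoint endomorphisms, Lorentzian algebra. -/

section Manifold

variable {d : ℕ} {M : Type*} [TopologicalSpace M]
  [ChartedSpace (EuclideanSpace ℝ (Fin d)) M]

theorem mem_eigenDistribution {S : ∀ x : M, TangentSpace (𝓡 d) x →L[ℝ] TangentSpace (𝓡 d) x}
    {f : M → ℝ} {x : M} {v : TangentSpace (𝓡 d) x} :
    v ∈ eigenDistribution S f x ↔ S x v = f x • v :=
  Module.End.mem_eigenspace_iff

variable [IsManifold (𝓡 d) ∞ M] {X Y : ∀ x : M, TangentSpace (𝓡 d) x}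

theorem SmoothField.add (hX : SmoothField X) (hY : SmoothField Y) : SmoothField (X + Y) :=
  ContMDiff.add_section hX hY

theorem SmoothField.sub (hX : SmoothField X) (hY : SmoothField Y) : SmoothField (X - Y) :=
  ContMDiff.sub_section hX hY

theorem SmoothField.sum {ι : Type*} {A : Finset ι} {X : ι → ∀ x : M, TangentSpace (𝓡 d) x}
    (hX : ∀ α ∈ A, SmoothField (X α)) : SmoothField (∑ α ∈ A, X α) := by
  have h : (fun x => (⟨x, (∑ α ∈ A, X α) x⟩ : TangentBundle (𝓡 d) M)) =
    fun x => (⟨x, ∑ α ∈ A, X α x⟩ : TangentBundle (𝓡 d) M) := by simp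
  unfold SmoothField
  rw [h]
  exact ContMDiff.sum_section hX

theorem smoothField_zero : SmoothField (0 : ∀ x : M, TangentSpace (𝓡 d) x) :=
  Bundle.contMDiff_zeroSection ℝ (TangentSpace (𝓡 d) : M → Type _)

theorem SmoothField.smul {f : M → ℝ} (hf : ContMDiff (𝓡 d) 𝓘(ℝ) ∞ f) (hX : SmoothField X) :
    SmoothField (fun x => f x • X x) :=
  ContMDiff.smul_section hf hX

theorem SmoothField.const_smul (c : ℝ) (hX : SmoothField X) : SmoothField (c • X) :=
  ContMDiff.const_smul_section hX

theorem SmoothEnd.apply {S : ∀ x : M, TangentSpace (𝓡 d) x →L[ℝ] TangentSpace (𝓡 d) x}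
    (hS : SmoothEnd S) (hX : SmoothField X) : SmoothField (fun x => S x (X x)) :=
  ContMDiff.clm_bundle_apply hS hX

end Manifold

/-- The spectral theorem, with `B` installed locally as the inner product. -/
theorem iSup_eigenspace_eq_top_of_posDef {V : Type*} [AddCommGroup V] [Module ℝ V]
    [FiniteDimensional ℝ V] (B : V →ₗ[ℝ] V →ₗ[ℝ] ℝ) (hB : ∀ v w, B v w = B w v)
    (hpos : ∀ v, v ≠ 0 → 0 < B v v) (T : V →ₗ[ℝ] V) (hT : ∀ v w, B (T v) w = B v (T w)) :
    ⨆ μ, Module.End.eigenspace T μ = ⊤ := by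
  let core : InnerProductSpace.Core ℝ V :=
    { inner := fun v w => B v w
      conj_inner_symm := fun v w => hB w v
      re_inner_nonneg := fun v => by
        by_cases h : v = 0
        · simp [h]
        · exact (hpos v h).le
      add_left := fun u v w => by simp
      smul_left := fun u v r => by simp
      definite := fun v h => by
        by_contra hv
        exact (hpos v hv).ne' h }
  let _ : NormedAddCommGroup V := core.toNormedAddCommGroup
  let _ : InnerProductSpace ℝ V := InnerProductSpace.ofCore core.toCore
  have hsym : T.IsSymmetric := fun v w => hT v w
  have := hsym.orthogonalComplement_iSup_eigenspaces_eq_bot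
  rwa [Submodule.orthogonal_eq_bot_iff] at this

namespace LorentzMetric

variable {n : ℕ} {N : Type*} [TopologicalSpace N]
  [ChartedSpace (EuclideanSpace ℝ (Fin (n + 2))) N] [IsManifold (𝓡 (n + 2)) ∞ N]

/-- A vector orthogonal to a nonzero null vector is not timelike. -/
theorem val_self_nonneg_of_orthogonal_null (g : LorentzMetric n N) {q : N}
    {e v : TangentSpace (𝓡 (n + 2)) q} (he : e ≠ 0) (hee : g.val q e e = 0)
    (hev : g.val q e v = 0) : 0 ≤ g.val q v v := by
  obtain ⟨b, hb⟩ := g.lorentzian q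
  have hval : ∀ u w, g.val q u w =
      -(b.repr u 0 * b.repr w 0) + ∑ i : Fin (n + 1), b.repr u i.succ * b.repr w i.succ := by
    intro u w
    conv_lhs => rw [← b.sum_repr u, ← b.sum_repr w]
    simp only [map_sum, map_smul, sum_apply, smul_apply, hb, smul_eq_mul]
    simp only [mul_ite, mul_zero, Finset.sum_ite_eq', Finset.mem_univ, if_true]
    rw [Fin.sum_univ_succ]
    simp [mul_comm]
  rw [hval] at hee hev ⊢
  -- Cauchy–Schwarz on spacelike parts: nullity of `e` and orthogonality turn it into `(e₀ v₀)² ≤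
  -- e₀² |v'|²`, and `e₀ ≠ 0` since otherwise nullity would force `e = 0`.
  have hcs := Finset.sum_mul_sq_le_sq_mul_sq Finset.univ (fun i : Fin (n + 1) => b.repr e i.succ)
    (fun i => b.repr v i.succ)
  simp only [← pow_two] at hee ⊢
  have h0 : b.repr e 0 ≠ 0 := by
    intro h0
    rw [h0] at hee
    have hz : ∑ i : Fin (n + 1), b.repr e i.succ ^ 2 = 0 := by linarith
    rw [Finset.sum_eq_zero_iff_of_nonneg fun _ _ => sq_nonneg _] at hz
    apply he
    rw [← b.forall_coord_eq_zero_iff]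
    intro j
    refine Fin.cases h0 (fun i => ?_) j
    simpa using hz i (Finset.mem_univ _)
  have hpos : 0 < b.repr e 0 ^ 2 := by positivity
  have h1 : ∑ i : Fin (n + 1), b.repr e i.succ ^ 2 = b.repr e 0 ^ 2 := by linarith
  have h2 : ∑ i : Fin (n + 1), b.repr e i.succ * b.repr v i.succ = b.repr e 0 * b.repr v 0 := by
    linarith
  rw [h1, h2, mul_pow] at hcs
  have := le_of_mul_le_mul_left hcs hpos
  linarith

end LorentzMetric

end NullGeometry

namespace NullGeometry
namespace LightlikeHypersurface

variable {n : ℕ} {N : Type*} [TopologicalSpace N]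
  [ChartedSpace (EuclideanSpace ℝ (Fin (n + 2))) N] [IsManifold (𝓡 (n + 2)) ∞ N]
  {M : Type*} [TopologicalSpace M]
  [ChartedSpace (EuclideanSpace ℝ (Fin (n + 1))) M] [IsManifold (𝓡 (n + 1)) ∞ M]
  (L : LightlikeHypersurface n N M)

/-! ### The induced metric, the form `η` and the screen -/

/-- The induced metric as a bilinear form. -/
def gForm (x : M) : TangentSpace (𝓡 (n + 1)) x →ₗ[ℝ] TangentSpace (𝓡 (n + 1)) x →ₗ[ℝ] ℝ :=
  LinearMap.mk₂ ℝ (L.g x) (fun u v w => by simp [g, inducedMetric])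
    (fun c u v => by simp [g, inducedMetric]) (fun u v w => by simp [g, inducedMetric])
    (fun c u v => by simp [g, inducedMetric])

theorem gForm_apply (x : M) (v w : TangentSpace (𝓡 (n + 1)) x) : L.gForm x v w = L.g x v w := rfl

/-- The one-form `η` as a linear map. -/
def ηForm (x : M) : TangentSpace (𝓡 (n + 1)) x →ₗ[ℝ] ℝ :=
  (L.gbar.val (L.i x) (L.transversal x)).toLinearMap ∘ₗ (L.di x).toLinearMap

theorem ηForm_apply (x : M) (v : TangentSpace (𝓡 (n + 1)) x) : L.ηForm x v = L.η x v := rfl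

/-- The nondegenerate metric `g̃` as a bilinear form. -/
def flatForm (x : M) : TangentSpace (𝓡 (n + 1)) x →ₗ[ℝ] TangentSpace (𝓡 (n + 1)) x →ₗ[ℝ] ℝ :=
  L.gForm x + LinearMap.mk₂ ℝ (fun v w => L.ηForm x v * L.ηForm x w)
    (fun u v w => by simp [add_mul]) (fun c u v => by simp [mul_assoc])
    (fun u v w => by simp [mul_add]) (fun c u v => by simp [mul_left_comm])

theorem flatForm_apply (x : M) (v w : TangentSpace (𝓡 (n + 1)) x) :
    L.flatForm x v w = L.flat x v w := rfl

theorem g_symm (x : M) (v w : TangentSpace (𝓡 (n + 1)) x) : L.g x v w = L.g x w v :=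
  L.gbar.symm _ _ _

theorem g_rad {x : M} {r : TangentSpace (𝓡 (n + 1)) x} (hr : r ∈ L.rad x)
    (w : TangentSpace (𝓡 (n + 1)) x) : L.g x r w = 0 := hr w

theorem η_ξ (x : M) : L.η x (L.ξ x) = 1 := (L.transversal_spec x).1

theorem η_screen {x : M} {v : TangentSpace (𝓡 (n + 1)) x} (hv : v ∈ L.screen x) : L.η x v = 0 :=
  (L.transversal_spec x).2.2 v hv

theorem eq_zero_of_mem_rad {x : M} {r : TangentSpace (𝓡 (n + 1)) x} (hr : r ∈ L.rad x)
    (hη : L.η x r = 0) : r = 0 := by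
  have hr' : r ∈ Submodule.span ℝ {L.ξ x} := (L.radical_eq x) ▸ hr
  obtain ⟨c, rfl⟩ := Submodule.mem_span_singleton.1 hr'
  rw [← ηForm_apply, map_smul, ηForm_apply, L.η_ξ] at hη
  rw [show c = 0 by simpa using hη, zero_smul]

theorem P_mem (x : M) (v : TangentSpace (𝓡 (n + 1)) x) : L.P x v ∈ L.screen x :=
  Submodule.projection_apply_mem ..

theorem sub_P_mem (x : M) (v : TangentSpace (𝓡 (n + 1)) x) : v - L.P x v ∈ L.rad x :=
  Submodule.sub_projection_mem ..

theorem P_of_mem {x : M} {v : TangentSpace (𝓡 (n + 1)) x} (hv : v ∈ L.screen x) :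
    L.P x v = v :=
  Submodule.projection_apply_of_mem_left _ hv

/-- If `η v = 0`, the radical vector `v - P v` is also killed by `η`, which is injective on the
radical line. -/
theorem mem_screen_iff {x : M} {v : TangentSpace (𝓡 (n + 1)) x} :
    v ∈ L.screen x ↔ L.η x v = 0 := by
  refine ⟨L.η_screen, fun h => ?_⟩
  have h1 : L.η x (v - L.P x v) = 0 := by
    rw [← ηForm_apply, map_sub, ηForm_apply, ηForm_apply, h, L.η_screen (L.P_mem x v), sub_zero]
  rw [sub_eq_zero.1 (L.eq_zero_of_mem_rad (L.sub_P_mem x v) h1)]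
  exact L.P_mem x v

theorem g_self_nonneg (x : M) (v : TangentSpace (𝓡 (n + 1)) x) : 0 ≤ L.g x v v :=
  L.gbar.val_self_nonneg_of_orthogonal_null
    (fun h => L.ξ_ne_zero x (L.injective_mfderiv x (h.trans (map_zero (L.di x)).symm)))
    (L.gbar_ξ x _) (L.gbar_ξ x v)

/-- For a semidefinite form, `g(v, v) = 0` forces `v` to be radical, and `η` detects nonzero radical
vectors. -/
theorem flat_self_pos (x : M) (v : TangentSpace (𝓡 (n + 1)) x) (hv : v ≠ 0) :
    0 < L.flat x v v := by
  have h0 := L.g_self_nonneg x v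
  have h1 : 0 ≤ L.η x v * L.η x v := mul_self_nonneg _
  refine lt_of_le_of_ne (add_nonneg h0 h1) fun h => hv ?_
  have h' : 0 = L.g x v v + L.η x v * L.η x v := h
  have hη : L.η x v = 0 := by
    apply mul_self_eq_zero.1
    linarith
  have hg : L.g x v v = 0 := by linarith
  refine L.eq_zero_of_mem_rad (fun w => ?_) hη
  change L.g x v w = 0
  have key : ∀ t : ℝ, 0 ≤ L.g x w w + 2 * t * L.g x v w := by
    intro t
    have := L.g_self_nonneg x (w + t • v)
    rw [← gForm_apply] at this
    simp only [map_add, map_smul, LinearMap.add_apply, LinearMap.smul_apply, gForm_apply,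
      smul_eq_mul, hg, L.g_symm x w v] at this
    linarith
  by_contra hne
  -- At this `t` the expression equals `-1`.
  have := key (-(L.g x w w + 1) / (2 * L.g x v w))
  field_simp at this
  linarith

theorem flat_rad {x : M} {r v : TangentSpace (𝓡 (n + 1)) x} (hr : r ∈ L.rad x)
    (hv : v ∈ L.screen x) : L.flat x r v = 0 := by
  unfold flat
  rw [L.g_rad hr, L.η_screen hv, mul_zero, add_zero]

theorem flat_screen {x : M} {v w : TangentSpace (𝓡 (n + 1)) x}
    (hv : v ∈ L.screen x) : L.flat x v w = L.g x v w := by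
  unfold flat
  rw [L.η_screen hv, zero_mul, add_zero]

/-- A function with radical gradient is constant along the screen. -/
theorem dirDeriv_eq_zero_of_grad_mem_rad {f : M → ℝ} {x : M} (hf : L.grad f x ∈ L.rad x)
    {v : TangentSpace (𝓡 (n + 1)) x} (hv : v ∈ L.screen x) : dirDeriv f x v = 0 := by
  have : FiniteDimensional ℝ (TangentSpace (𝓡 (n + 1)) x) :=
    inferInstanceAs (FiniteDimensional ℝ (EuclideanSpace ℝ (Fin (n + 1))))
  have h := representing_spec (L.flatForm x) (fun v hv => L.flat_nondegenerate x v hv)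
    ({ toFun := dirDeriv f x
       map_add' := dirDeriv_add_dir f x
       map_smul' := dirDeriv_smul_dir f x } : TangentSpace (𝓡 (n + 1)) x →ₗ[ℝ] ℝ) v
  exact h.symm.trans (L.flat_rad hf hv)

/-! ### The induced connection of a totally geodesic hypersurface -/

namespace TotallyGeodesic

variable {L} {X Y Z : ∀ x : M, TangentSpace (𝓡 (n + 1)) x}

/-- With injectivity of `di`, this transfers the rules of the ambient derivative to `∇` without
unfolding the chosen projection `Q`. -/
theorem di_nabla (hL : L.TotallyGeodesic) (hX : SmoothField X) (hY : SmoothField Y) (x : M) :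
    L.di x (L.nabla X Y x) = L.nablaBar X Y x :=
  (sub_eq_zero.1 (hL X Y hX hY x)).symm

theorem nabla_add (hL : L.TotallyGeodesic) (hX : SmoothField X) (hY : SmoothField Y)
    (hZ : SmoothField Z) (x : M) :
    L.nabla X (Y + Z) x = L.nabla X Y x + L.nabla X Z x := by
  apply L.injective_mfderiv x
  change L.di x _ = L.di x _
  rw [map_add, hL.di_nabla hX hY, hL.di_nabla hX hZ, hL.di_nabla hX (hY.add hZ)]
  have h : (fun y => L.di y ((Y + Z) y)) = fun y => L.di y (Y y) + L.di y (Z y) :=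
    funext fun y => map_add _ _ _
  unfold nablaBar
  rw [h]
  exact leviCivitaAlong_add _ (differentiableAlong_mfderiv L.contMDiff_i hY x)
    (differentiableAlong_mfderiv L.contMDiff_i hZ x) _

theorem nabla_smul (hL : L.TotallyGeodesic) (hX : SmoothField X) (hY : SmoothField Y)
    {f : M → ℝ} (hf : ContMDiff (𝓡 (n + 1)) 𝓘(ℝ) ∞ f) (x : M) :
    L.nabla X (fun y => f y • Y y) x = dirDeriv f x (X x) • Y x + f x • L.nabla X Y x := by
  apply L.injective_mfderiv x
  change L.di x _ = L.di x _
  rw [map_add, map_smul, map_smul, hL.di_nabla hX hY, hL.di_nabla hX (hY.smul hf)]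
  have h : (fun y => L.di y (f y • Y y)) = fun y => f y • L.di y (Y y) :=
    funext fun y => map_smul _ _ _
  unfold nablaBar
  rw [h]
  exact leviCivitaAlong_smul _ (hf.mdifferentiableAt (by simp))
    (differentiableAlong_mfderiv L.contMDiff_i hY x) _

theorem nabla_add_dir (hL : L.TotallyGeodesic) (hX : SmoothField X) (hY : SmoothField Y)
    (hZ : SmoothField Z) (x : M) :
    L.nabla (X + Y) Z x = L.nabla X Z x + L.nabla Y Z x := by
  apply L.injective_mfderiv x
  change L.di x _ = L.di x _
  rw [map_add, hL.di_nabla hX hZ, hL.di_nabla hY hZ, hL.di_nabla (hX.add hY) hZ]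
  exact leviCivitaAlong_add_dir ..

theorem nabla_smul_dir (hL : L.TotallyGeodesic) (hX : SmoothField X) (hY : SmoothField Y)
    (c : ℝ) (x : M) : L.nabla (c • X) Y x = c • L.nabla X Y x := by
  apply L.injective_mfderiv x
  change L.di x _ = L.di x _
  rw [map_smul, hL.di_nabla hX hY, hL.di_nabla (hX.const_smul c) hY]
  exact leviCivitaAlong_smul_dir ..

theorem nabla_const_smul (hL : L.TotallyGeodesic) (hX : SmoothField X) (hY : SmoothField Y)
    (c : ℝ) (x : M) : L.nabla X (c • Y) x = c • L.nabla X Y x := by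
  have h := hL.nabla_smul hX hY (f := fun _ => c) contMDiff_const x
  rwa [dirDeriv_const, zero_smul, zero_add] at h

/-- The induced connection of a totally geodesic hypersurface is metric. -/
theorem dirDeriv_g (hL : L.TotallyGeodesic) (hX : SmoothField X) (hY : SmoothField Y)
    (hZ : SmoothField Z) (x : M) :
    dirDeriv (fun y => L.g y (Y y) (Z y)) x (X x) =
      L.g x (L.nabla X Y x) (Z x) + L.g x (Y x) (L.nabla X Z x) := by
  have h := dirDeriv_val L.gbar (L.contMDiff_i.mdifferentiableAt (by simp))
    (differentiableAlong_mfderiv L.contMDiff_i hY x)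
    (differentiableAlong_mfderiv L.contMDiff_i hZ x) (X x)
  refine h.trans ?_
  have h1 := hL.di_nabla hX hY x
  have h2 := hL.di_nabla hX hZ x
  change _ = L.gbar.val _ (L.di x _) _ + L.gbar.val _ _ (L.di x _)
  rw [h1, h2]
  rfl

/-- The induced connection of a totally geodesic hypersurface is torsion free. -/
theorem nabla_sub_nabla (hL : L.TotallyGeodesic) (hX : SmoothField X) (hY : SmoothField Y)
    (x : M) :
    L.nabla X Y x - L.nabla Y X x = VectorField.mlieBracket (𝓡 (n + 1)) X Y x := by
  apply L.injective_mfderiv x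
  change L.di x _ = L.di x _
  rw [map_sub, hL.di_nabla hX hY, hL.di_nabla hY hX]
  exact leviCivitaAlong_sub_leviCivitaAlong _ L.contMDiff_i hX hY x

/-- Differentiate the identically zero function `g(Y, Z)`. -/
theorem g_nabla_eq_neg (hL : L.TotallyGeodesic) (hX : SmoothField X) (hY : SmoothField Y)
    (hZ : SmoothField Z) (h : ∀ x, L.g x (Y x) (Z x) = 0) (x : M) :
    L.g x (L.nabla X Y x) (Z x) = -L.g x (L.nabla X Z x) (Y x) := by
  have h1 := hL.dirDeriv_g hX hY hZ x
  simp only [h, dirDeriv_const] at h1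
  rw [L.g_symm x (Y x)] at h1
  linarith

variable {S : ∀ x : M, TangentSpace (𝓡 (n + 1)) x →L[ℝ] TangentSpace (𝓡 (n + 1)) x}

theorem nablaEnd_add (hL : L.TotallyGeodesic) (hS : SmoothEnd S) (hX : SmoothField X)
    (hY : SmoothField Y) (hZ : SmoothField Z) (x : M) :
    L.nablaEnd S X (Y + Z) x = L.nablaEnd S X Y x + L.nablaEnd S X Z x := by
  have h : (fun y => S y ((Y + Z) y)) = (fun y => S y (Y y)) + fun y => S y (Z y) :=
    funext fun y => map_add _ _ _
  unfold nablaEnd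
  rw [h, hL.nabla_add hX (hS.apply hY) (hS.apply hZ), hL.nabla_add hX hY hZ, map_add]
  abel

theorem nablaEnd_add_dir (hL : L.TotallyGeodesic) (hS : SmoothEnd S) (hX : SmoothField X)
    (hY : SmoothField Y) (hZ : SmoothField Z) (x : M) :
    L.nablaEnd S (X + Y) Z x = L.nablaEnd S X Z x + L.nablaEnd S Y Z x := by
  unfold nablaEnd
  rw [hL.nabla_add_dir hX hY (hS.apply hZ), hL.nabla_add_dir hX hY hZ, map_add]
  abel

theorem nablaEnd_zero (hL : L.TotallyGeodesic) (hS : SmoothEnd S) (hX : SmoothField X) (x : M) :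
    L.nablaEnd S X 0 x = 0 := by
  simpa using hL.nablaEnd_add hS hX smoothField_zero smoothField_zero x

theorem nablaEnd_zero_dir (hL : L.TotallyGeodesic) (hS : SmoothEnd S) (hX : SmoothField X)
    (x : M) : L.nablaEnd S 0 X x = 0 := by
  simpa using hL.nablaEnd_add_dir hS smoothField_zero smoothField_zero hX x

end TotallyGeodesic

/-! ### Eigenspace distributions of an `𝒜^∇`-tensor -/

section Eigen

variable {L} {S : ∀ x : M, TangentSpace (𝓡 (n + 1)) x →L[ℝ] TangentSpace (𝓡 (n + 1)) x}
  {k : ℕ} {lam : Fin (k + 1) → M → ℝ}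

theorem IsATensor.apply_mem_screen (hS : L.IsATensor S) {x : M} {v : TangentSpace (𝓡 (n + 1)) x}
    (hv : v ∈ L.screen x) : S x v ∈ L.screen x := by
  rw [← L.P_of_mem hv, ← hS.screen_preserving]
  exact L.P_mem x _

/-- `S` preserves the screen, which is killed by `η`, and acts by `λ_0` on the radical. This
upgrades symmetry for `g` to symmetry for `g̃`. -/
theorem IsATensor.η_apply (hS : L.IsATensor S) (hlam : L.IsEigenfunctions S lam) (x : M)
    (v : TangentSpace (𝓡 (n + 1)) x) : L.η x (S x v) = lam 0 x * L.η x v := by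
  have hr : v - L.P x v ∈ eigenDistribution S (lam 0) x := by
    rw [hlam.eigen_zero]
    exact L.sub_P_mem x v
  have h1 := congrArg (L.ηForm x) (mem_eigenDistribution.1 hr)
  simp only [map_sub, map_smul, smul_eq_mul, ηForm_apply] at h1
  rw [L.η_screen (L.P_mem x v), L.η_screen (hS.apply_mem_screen (L.P_mem x v))] at h1
  simpa using h1

theorem IsATensor.flat_apply (hS : L.IsATensor S) (hlam : L.IsEigenfunctions S lam) (x : M)
    (v w : TangentSpace (𝓡 (n + 1)) x) : L.flat x (S x v) w = L.flat x v (S x w) := by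
  unfold flat
  rw [hS.symmetric, hS.η_apply hlam, hS.η_apply hlam]
  ring

theorem IsATensor.iSup_eigenDistribution (hS : L.IsATensor S) (hlam : L.IsEigenfunctions S lam)
    (x : M) : ⨆ α, eigenDistribution S (lam α) x = ⊤ := by
  have : FiniteDimensional ℝ (TangentSpace (𝓡 (n + 1)) x) :=
    inferInstanceAs (FiniteDimensional ℝ (EuclideanSpace ℝ (Fin (n + 1))))
  rw [eq_top_iff, ← iSup_eigenspace_eq_top_of_posDef (L.flatForm x)
    (fun v w => by rw [flatForm_apply, flatForm_apply, flat, flat, L.g_symm x v, mul_comm])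
    (L.flat_self_pos x) (S x).toLinearMap (hS.flat_apply hlam x)]
  refine iSup_le fun μ => ?_
  by_cases h : Module.End.HasEigenvalue (S x).toLinearMap μ
  · obtain ⟨α, rfl⟩ := (hlam.eigenvalue_iff x μ).1 h
    exact le_iSup (fun α => eigenDistribution S (lam α) x) α
  · have h' : Module.End.eigenspace (S x).toLinearMap μ = ⊥ := by
      by_contra hne
      exact h (Module.End.hasEigenvalue_iff.2 hne)
    rw [h']
    exact bot_le

/-- Applying `η` to the eigenvalue equation gives `(λ_α - λ_0) η(v) = 0`. -/
theorem IsATensor.eigenDistribution_le_screen (hS : L.IsATensor S)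
    (hlam : L.IsEigenfunctions S lam) {α : Fin (k + 1)} (hα : α ≠ 0) (x : M) :
    eigenDistribution S (lam α) x ≤ L.screen x := by
  intro v hv
  have h1 := hS.η_apply hlam x v
  rw [mem_eigenDistribution.1 hv, ← ηForm_apply, map_smul, smul_eq_mul, ηForm_apply] at h1
  have h2 : lam α x - lam 0 x ≠ 0 := sub_ne_zero.2 fun h => hα (hlam.distinct x h)
  rw [L.mem_screen_iff]
  refine (mul_eq_zero.1 (?_ : (lam α x - lam 0 x) * L.η x v = 0)).resolve_left h2
  linarith

theorem IsATensor.g_eq_zero (hS : L.IsATensor S) (hlam : L.IsEigenfunctions S lam)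
    {α β : Fin (k + 1)} (h : α ≠ β) {x : M} {v w : TangentSpace (𝓡 (n + 1)) x}
    (hv : v ∈ eigenDistribution S (lam α) x) (hw : w ∈ eigenDistribution S (lam β) x) :
    L.g x v w = 0 := by
  have h1 := hS.symmetric x v w
  rw [mem_eigenDistribution.1 hv, mem_eigenDistribution.1 hw, ← gForm_apply, ← gForm_apply] at h1
  simp only [map_smul, LinearMap.smul_apply, smul_eq_mul, gForm_apply] at h1
  have h2 : lam α x - lam β x ≠ 0 := sub_ne_zero.2 fun he => h (hlam.distinct x he)
  refine (mul_eq_zero.1 (?_ : (lam α x - lam β x) * L.g x v w = 0)).resolve_left h2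
  linarith

theorem IsATensor.screen_le_iSup (hS : L.IsATensor S) (hlam : L.IsEigenfunctions S lam) (x : M) :
    L.screen x ≤ ⨆ α ∈ Finset.univ.erase 0, eigenDistribution S (lam α) x := by
  intro v hv
  have h0 : ⨆ α, eigenDistribution S (lam α) x ≤ L.rad x ⊔
      ⨆ α ∈ Finset.univ.erase 0, eigenDistribution S (lam α) x := by
    refine iSup_le fun α => ?_
    by_cases hα : α = 0
    · rw [hα, hlam.eigen_zero]
      exact le_sup_left
    · exact le_sup_of_le_right (le_iSup₂_of_le α (by simp [hα]) le_rfl)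
  rw [hS.iSup_eigenDistribution hlam] at h0
  obtain ⟨r, hr, s, hs, rfl⟩ := Submodule.mem_sup.1 (h0 (Submodule.mem_top (x := v)))
  have hle : ⨆ α ∈ Finset.univ.erase (0 : Fin (k + 1)), eigenDistribution S (lam α) x ≤
      L.screen x :=
    iSup₂_le fun α hα => hS.eigenDistribution_le_screen hlam (Finset.ne_of_mem_erase hα) x
  have hr0 : r = 0 := by
    apply L.eq_zero_of_mem_rad hr
    apply L.η_screen
    simpa using Submodule.sub_mem _ hv (hle hs)
  simpa [hr0] using hs

/-- A smooth field in a sum of eigenspace distributions is a sum of smooth sections of them. -/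
theorem IsEigenfunctions.exists_eq_sum (hlam : L.IsEigenfunctions S lam) (hS : SmoothEnd S)
    (A : Finset (Fin (k + 1))) :
    ∀ V : ∀ x : M, TangentSpace (𝓡 (n + 1)) x,
      IsSection (fun x => ⨆ α ∈ A, eigenDistribution S (lam α) x) V →
      ∃ W : Fin (k + 1) → ∀ x : M, TangentSpace (𝓡 (n + 1)) x,
        (∀ α, IsSection (eigenDistribution S (lam α)) (W α)) ∧ V = ∑ α ∈ A, W α := by
  induction A using Finset.induction_on with
  | empty =>
    intro V hV
    refine ⟨fun _ => 0, fun α => ⟨smoothField_zero, fun x => Submodule.zero_mem _⟩, ?_⟩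
    funext x
    simpa using hV.2 x
  | insert a B ha ih =>
    intro V hV
    -- `S - λ_a` kills the `D_a` component and scales the `D_β` component by `λ_β - λ_a`. The
    -- induction hypothesis splits the image, division recovers the other components smoothly, and
    -- what remains of `V` lies in `D_a`.
    have hV1 : SmoothField ((fun x => S x (V x)) - fun x => lam a x • V x) :=
      (hS.apply hV.1).sub (hV.1.smul (hlam.smooth a))
    obtain ⟨W, hW, hsum⟩ := ih _ ⟨hV1, fun x => by
      have hx := hV.2 x
      simp only [Finset.iSup_insert] at hx
      obtain ⟨u, hu, w, hw, huw⟩ := Submodule.mem_sup.1 hx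
      have hB : ∀ w ∈ ⨆ α ∈ B, eigenDistribution S (lam α) x,
          S x w ∈ ⨆ α ∈ B, eigenDistribution S (lam α) x := by
        intro w hw
        suffices h : ⨆ α ∈ B, eigenDistribution S (lam α) x ≤
            (⨆ α ∈ B, eigenDistribution S (lam α) x).comap (S x).toLinearMap from h hw
        refine iSup₂_le fun α hα v hv => ?_
        change S x v ∈ ⨆ α ∈ B, eigenDistribution S (lam α) x
        rw [mem_eigenDistribution.1 hv]
        exact Submodule.smul_mem _ _
          (Submodule.mem_iSup_of_mem α (Submodule.mem_iSup_of_mem hα hv))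
      have he : S x (V x) - lam a x • V x = S x w - lam a x • w := by
        rw [← huw, map_add, mem_eigenDistribution.1 hu]
        module
      change S x (V x) - lam a x • V x ∈ _
      rw [he]
      exact Submodule.sub_mem _ (hB w hw) (Submodule.smul_mem _ _ hw)⟩
    have hne : ∀ β ∈ B, ∀ x, lam β x - lam a x ≠ 0 := fun β hβ x =>
      sub_ne_zero.2 fun h => ha (hlam.distinct x h ▸ hβ)
    let U : Fin (k + 1) → ∀ x : M, TangentSpace (𝓡 (n + 1)) x := fun β =>
      if β ∈ B then fun x => (lam β x - lam a x)⁻¹ • W β x else 0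
    have hU : ∀ β, IsSection (eigenDistribution S (lam β)) (U β) := by
      intro β
      by_cases hβ : β ∈ B
      · simp only [U, if_pos hβ]
        exact ⟨(hW β).1.smul (((hlam.smooth β).sub (hlam.smooth a)).inv₀ (hne β hβ)),
          fun x => Submodule.smul_mem _ _ ((hW β).2 x)⟩
      · simp only [U, if_neg hβ]
        exact ⟨smoothField_zero, fun x => Submodule.zero_mem _⟩
    refine ⟨Function.update U a (V - ∑ β ∈ B, U β), fun α => ?_, ?_⟩
    · by_cases hα : α = a
      · subst hα
        rw [Function.update_self]
        refine ⟨hV.1.sub (SmoothField.sum fun β _ => (hU β).1), fun x => ?_⟩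
        rw [mem_eigenDistribution]
        have h1 : S x (V x) - lam α x • V x = ∑ β ∈ B, W β x := by
          simpa using congrFun hsum x
        have h2 : ∑ β ∈ B, W β x = ∑ β ∈ B, (S x (U β x) - lam α x • U β x) := by
          refine Finset.sum_congr rfl fun β hβ => ?_
          rw [mem_eigenDistribution.1 ((hU β).2 x), ← sub_smul]
          simp only [U, if_pos hβ]
          rw [smul_inv_smul₀ (hne β hβ x)]
        rw [h2, Finset.sum_sub_distrib, ← Finset.smul_sum] at h1
        simp only [Pi.sub_apply, Finset.sum_apply, map_sub, map_sum]
        rw [smul_sub, sub_eq_sub_iff_sub_eq_sub]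
        exact h1
      · rw [Function.update_of_ne hα]
        exact hU α
    · rw [Finset.sum_insert ha, Function.update_self]
      have : ∑ β ∈ B, Function.update U a (V - ∑ β ∈ B, U β) β = ∑ β ∈ B, U β :=
        Finset.sum_congr rfl fun β hβ => Function.update_of_ne (fun h : β = a => ha (h ▸ hβ)) _ _
      rw [this, sub_add_cancel]

/-- To prove an additive property of the smooth fields in a sum of eigenspace distributions, it
suffices to prove it for the sections of each of them. -/
theorem IsEigenfunctions.section_induction (hlam : L.IsEigenfunctions S lam) (hS : SmoothEnd S)
    {A : Finset (Fin (k + 1))} {p : (∀ x : M, TangentSpace (𝓡 (n + 1)) x) → Prop} (zero : p 0)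
    (add : ∀ V W, SmoothField V → SmoothField W → p V → p W → p (V + W))
    (mem : ∀ α ∈ A, ∀ V, IsSection (eigenDistribution S (lam α)) V → p V)
    {V : ∀ x : M, TangentSpace (𝓡 (n + 1)) x}
    (hV : IsSection (fun x => ⨆ α ∈ A, eigenDistribution S (lam α) x) V) : p V := by
  obtain ⟨W, hW, rfl⟩ := hlam.exists_eq_sum hS A V hV
  refine (Finset.sum_induction W (fun V => SmoothField V ∧ p V)
    (fun V W hV hW => ⟨hV.1.add hW.1, add V W hV.1 hW.1 hV.2 hW.2⟩) ⟨smoothField_zero, zero⟩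
    fun α hα => ⟨(hW α).1, mem α hα _ (hW α)⟩).2

end Eigen

end LightlikeHypersurface
end NullGeometry

/-! ### Vanishing of `∇S` between eigenspace distributions. -/

namespace NullGeometry
namespace LightlikeHypersurface

variable {n : ℕ} {N : Type*} [TopologicalSpace N]
  [ChartedSpace (EuclideanSpace ℝ (Fin (n + 2))) N] [IsManifold (𝓡 (n + 2)) ∞ N]
  {M : Type*} [TopologicalSpace M]
  [ChartedSpace (EuclideanSpace ℝ (Fin (n + 1))) M] [IsManifold (𝓡 (n + 1)) ∞ M]
  {L : LightlikeHypersurface n N M}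
  {S : ∀ x : M, TangentSpace (𝓡 (n + 1)) x →L[ℝ] TangentSpace (𝓡 (n + 1)) x}
  {k : ℕ} {lam : Fin (k + 1) → M → ℝ} {X Y Z : ∀ x : M, TangentSpace (𝓡 (n + 1)) x}
  {α β γ : Fin (k + 1)}

/-- The Leibniz term `X(λ_β) Y` vanishes because the gradient is radical; symmetry of `S` lets it
act on `Z` in the other term. -/
theorem TotallyGeodesic.g_nablaEnd (hL : L.TotallyGeodesic) (hS : L.IsATensor S)
    (hlam : L.IsEigenfunctions S lam) (hgrad : ∀ α x, L.grad (lam α) x ∈ L.rad x)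
    (hX : IsSection L.screen X) (hY : IsSection (eigenDistribution S (lam β)) Y)
    (hZ : IsSection (eigenDistribution S (lam γ)) Z) (x : M) :
    L.g x (L.nablaEnd S X Y x) (Z x) =
      (lam β x - lam γ x) * L.g x (L.nabla X Y x) (Z x) := by
  have h : (fun y => S y (Y y)) = fun y => lam β y • Y y :=
    funext fun y => mem_eigenDistribution.1 (hY.2 y)
  unfold nablaEnd
  rw [h, hL.nabla_smul hX.1 hY.1 (hlam.smooth β),
    L.dirDeriv_eq_zero_of_grad_mem_rad (hgrad β x) (hX.2 x), zero_smul, zero_add, ← gForm_apply]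
  simp only [map_sub, map_smul, LinearMap.sub_apply, LinearMap.smul_apply, gForm_apply,
    smul_eq_mul]
  rw [hS.symmetric, mem_eigenDistribution.1 (hZ.2 x), ← gForm_apply _ _ _ (lam γ x • Z x)]
  simp only [map_smul, gForm_apply, smul_eq_mul]
  ring

theorem IsATensor.isSection_screen (hS : L.IsATensor S) (hlam : L.IsEigenfunctions S lam)
    (hα : α ≠ 0) (hX : IsSection (eigenDistribution S (lam α)) X) : IsSection L.screen X :=
  ⟨hX.1, fun x => hS.eigenDistribution_le_screen hlam hα x (hX.2 x)⟩

/-- Covariant differentiation commutes on sections of two eigenspace distributions, up to vectors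
orthogonal to the remaining ones. -/
theorem TotallyGeodesic.g_nabla_comm (hL : L.TotallyGeodesic) (hS : L.IsATensor S)
    (hlam : L.IsEigenfunctions S lam)
    (hprod : IntegrableAlmostProduct fun α => eigenDistribution S (lam α))
    (hγα : γ ≠ α) (hγβ : γ ≠ β) (hX : IsSection (eigenDistribution S (lam α)) X)
    (hY : IsSection (eigenDistribution S (lam β)) Y)
    (hZ : IsSection (eigenDistribution S (lam γ)) Z) (x : M) :
    L.g x (L.nabla X Y x) (Z x) = L.g x (L.nabla Y X x) (Z x) := by
  have hsec : ∀ δ ∈ ({α, β} : Finset (Fin (k + 1))), ∀ {V : ∀ x : M, TangentSpace (𝓡 (n + 1)) x},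
      IsSection (eigenDistribution S (lam δ)) V →
        IsSection (fun x => ⨆ δ ∈ ({α, β} : Finset (Fin (k + 1))),
          eigenDistribution S (lam δ) x) V :=
    fun δ hδ V hV => ⟨hV.1, fun x =>
      Submodule.mem_iSup_of_mem δ (Submodule.mem_iSup_of_mem hδ (hV.2 x))⟩
  -- The case `α = β` is allowed: the set is then a singleton, and integrability of `D_α` is what is
  -- used.
  have hbr := hprod {α, β} X Y (hsec α (by simp) hX) (hsec β (by simp) hY) x
  have hle : ⨆ δ ∈ ({α, β} : Finset (Fin (k + 1))), eigenDistribution S (lam δ) x ≤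
      LinearMap.ker (L.gForm x (Z x)) := by
    refine iSup₂_le fun δ hδ v hv => ?_
    have hne : γ ≠ δ := by
      rcases Finset.mem_insert.1 hδ with rfl | h
      · exact hγα
      · rwa [Finset.mem_singleton.1 h]
    exact hS.g_eq_zero hlam hne (hZ.2 x) hv
  have h0 : L.gForm x (Z x) _ = 0 := hle hbr
  rw [← hL.nabla_sub_nabla hX.1 hY.1, map_sub, gForm_apply, gForm_apply, L.g_symm, L.g_symm x (Z x)]
    at h0
  exact sub_eq_zero.1 h0

/-- Expand the `𝒜^∇` identity at `X + Z` into eight terms. Four carry a factor `λ - λ = 0`; skew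
symmetry combines the others into `2 (λ_α - λ_γ) (g(∇_X X, Z) - g(∇_Z Z, X))`. -/
theorem TotallyGeodesic.g_nabla_self_comm (hL : L.TotallyGeodesic) (hS : L.IsATensor S)
    (hlam : L.IsEigenfunctions S lam) (hgrad : ∀ α x, L.grad (lam α) x ∈ L.rad x)
    (hα : α ≠ 0) (hγ : γ ≠ 0) (hαγ : α ≠ γ) (hX : IsSection (eigenDistribution S (lam α)) X)
    (hZ : IsSection (eigenDistribution S (lam γ)) Z) (x : M) :
    L.g x (L.nabla X X x) (Z x) = L.g x (L.nabla Z Z x) (X x) := by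
  have hXs := hS.isSection_screen hlam hα hX
  have hZs := hS.isSection_screen hlam hγ hZ
  have hne : lam α x - lam γ x ≠ 0 := sub_ne_zero.2 fun h => hαγ (hlam.distinct x h)
  have h := hS.flat_nablaEnd (X + Z) (hX.1.add hZ.1) x
  rw [Pi.add_apply, L.flat_screen (Submodule.add_mem _ (hXs.2 x) (hZs.2 x)),
    hL.nablaEnd_add hS.smooth (hX.1.add hZ.1) hX.1 hZ.1,
    hL.nablaEnd_add_dir hS.smooth hX.1 hZ.1 hX.1, hL.nablaEnd_add_dir hS.smooth hX.1 hZ.1 hZ.1,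
    L.g_symm, ← gForm_apply] at h
  simp only [map_add, LinearMap.add_apply, gForm_apply] at h
  rw [hL.g_nablaEnd hS hlam hgrad hXs hX hX, hL.g_nablaEnd hS hlam hgrad hXs hX hZ,
    hL.g_nablaEnd hS hlam hgrad hXs hZ hX, hL.g_nablaEnd hS hlam hgrad hXs hZ hZ,
    hL.g_nablaEnd hS hlam hgrad hZs hX hX, hL.g_nablaEnd hS hlam hgrad hZs hX hZ,
    hL.g_nablaEnd hS hlam hgrad hZs hZ hX, hL.g_nablaEnd hS hlam hgrad hZs hZ hZ,
    hL.g_nabla_eq_neg hX.1 hZ.1 hX.1 fun y => hS.g_eq_zero hlam hαγ.symm (hZ.2 y) (hX.2 y),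
    hL.g_nabla_eq_neg hZ.1 hX.1 hZ.1 fun y => hS.g_eq_zero hlam hαγ (hX.2 y) (hZ.2 y)] at h
  apply mul_left_cancel₀ hne
  linarith

/-- In the preceding equality one side is odd in `Z` and the other even, so comparing `Z` with `-Z`
kills both. -/
theorem TotallyGeodesic.g_nabla_self_eq_zero (hL : L.TotallyGeodesic) (hS : L.IsATensor S)
    (hlam : L.IsEigenfunctions S lam) (hgrad : ∀ α x, L.grad (lam α) x ∈ L.rad x)
    (hα : α ≠ 0) (hγ : γ ≠ 0) (hαγ : α ≠ γ) (hX : IsSection (eigenDistribution S (lam α)) X)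
    (hZ : IsSection (eigenDistribution S (lam γ)) Z) (x : M) :
    L.g x (L.nabla X X x) (Z x) = 0 := by
  have hZ' : IsSection (eigenDistribution S (lam γ)) ((-1 : ℝ) • Z) :=
    ⟨hZ.1.const_smul _, fun y => Submodule.smul_mem _ _ (hZ.2 y)⟩
  have h1 := hL.g_nabla_self_comm hS hlam hgrad hα hγ hαγ hX hZ x
  have h2 := hL.g_nabla_self_comm hS hlam hgrad hα hγ hαγ hX hZ' x
  rw [hL.nabla_smul_dir hZ.1 hZ'.1, hL.nabla_const_smul hZ.1 hZ.1, Pi.smul_apply, smul_smul,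
    ← gForm_apply, map_smul, gForm_apply, smul_eq_mul] at h2
  norm_num at h2
  linarith

/-- Eigenspace distributions of the screen are totally geodesic. -/
theorem TotallyGeodesic.g_nabla_eq_zero_of_mem (hL : L.TotallyGeodesic) (hS : L.IsATensor S)
    (hlam : L.IsEigenfunctions S lam) (hgrad : ∀ α x, L.grad (lam α) x ∈ L.rad x)
    (hprod : IntegrableAlmostProduct fun α => eigenDistribution S (lam α))
    (hα : α ≠ 0) (hγ : γ ≠ 0) (hαγ : α ≠ γ) (hX : IsSection (eigenDistribution S (lam α)) X)
    (hY : IsSection (eigenDistribution S (lam α)) Y)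
    (hZ : IsSection (eigenDistribution S (lam γ)) Z) (x : M) :
    L.g x (L.nabla X Y x) (Z x) = 0 := by
  have hXY : IsSection (eigenDistribution S (lam α)) (X + Y) :=
    ⟨hX.1.add hY.1, fun y => Submodule.add_mem _ (hX.2 y) (hY.2 y)⟩
  -- Polarization gives skewness in `X, Y`; the bracket condition gives symmetry.
  have h := hL.g_nabla_self_eq_zero hS hlam hgrad hα hγ hαγ hXY hZ x
  rw [hL.nabla_add hXY.1 hX.1 hY.1, hL.nabla_add_dir hX.1 hY.1 hX.1,
    hL.nabla_add_dir hX.1 hY.1 hY.1, ← gForm_apply] at h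
  simp only [map_add, LinearMap.add_apply, gForm_apply] at h
  rw [hL.g_nabla_self_eq_zero hS hlam hgrad hα hγ hαγ hX hZ,
    hL.g_nabla_self_eq_zero hS hlam hgrad hα hγ hαγ hY hZ,
    hL.g_nabla_comm hS hlam hprod hαγ.symm hαγ.symm hY hX hZ] at h
  linarith

theorem TotallyGeodesic.g_nabla_eq_zero (hL : L.TotallyGeodesic) (hS : L.IsATensor S)
    (hlam : L.IsEigenfunctions S lam) (hgrad : ∀ α x, L.grad (lam α) x ∈ L.rad x)
    (hprod : IntegrableAlmostProduct fun α => eigenDistribution S (lam α))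
    (hα : α ≠ 0) (hβ : β ≠ 0) (hγ : γ ≠ 0) (hβγ : β ≠ γ)
    (hX : IsSection (eigenDistribution S (lam α)) X)
    (hY : IsSection (eigenDistribution S (lam β)) Y)
    (hZ : IsSection (eigenDistribution S (lam γ)) Z) (x : M) :
    L.g x (L.nabla X Y x) (Z x) = 0 := by
  by_cases hαβ : α = β
  · subst hαβ
    exact hL.g_nabla_eq_zero_of_mem hS hlam hgrad hprod hα hγ hβγ hX hY hZ x
  have hYZ : ∀ y, L.g y (Y y) (Z y) = 0 := fun y => hS.g_eq_zero hlam hβγ (hY.2 y) (hZ.2 y)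
  have hXY : ∀ y, L.g y (X y) (Y y) = 0 := fun y => hS.g_eq_zero hlam hαβ (hX.2 y) (hY.2 y)
  by_cases hαγ : α = γ
  · subst hαγ
    rw [hL.g_nabla_eq_neg hX.1 hY.1 hZ.1 hYZ,
      hL.g_nabla_eq_zero_of_mem hS hlam hgrad hprod hα hβ hαβ hX hZ hY, neg_zero]
  have hXZ : ∀ y, L.g y (X y) (Z y) = 0 := fun y => hS.g_eq_zero hlam hαγ (hX.2 y) (hZ.2 y)
  -- Distinct indices: symmetry in the first two slots and skewness in the last two, alternated
  -- around all six permutations, give `T = -T`.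
  have h1 := hL.g_nabla_comm hS hlam hprod (Ne.symm hαγ) hβγ.symm hX hY hZ x
  have h2 := hL.g_nabla_comm hS hlam hprod (Ne.symm hαβ) hβγ hX hZ hY x
  have h3 := hL.g_nabla_comm hS hlam hprod hαβ hαγ hY hZ hX x
  have h4 := hL.g_nabla_eq_neg hX.1 hY.1 hZ.1 hYZ x
  have h5 := hL.g_nabla_eq_neg hY.1 hX.1 hZ.1 hXZ x
  have h6 := hL.g_nabla_eq_neg hZ.1 hX.1 hY.1 hXY x
  linarith

/-- Each argument is split into global eigensections, so additivity in each slot suffices and no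
tensoriality is needed. `Z` may be any smooth field, since its radical part is `g`-orthogonal to
everything. -/
theorem TotallyGeodesic.g_nablaEnd_eq_zero (hL : L.TotallyGeodesic) (hS : L.IsATensor S)
    (hlam : L.IsEigenfunctions S lam) (hgrad : ∀ α x, L.grad (lam α) x ∈ L.rad x)
    (hprod : IntegrableAlmostProduct fun α => eigenDistribution S (lam α))
    (hX : IsSection L.screen X) (hY : IsSection L.screen Y) (hZ : SmoothField Z) (x : M) :
    L.g x (L.nablaEnd S X Y x) (Z x) = 0 := by
  have hdec : ∀ {V : ∀ x : M, TangentSpace (𝓡 (n + 1)) x}, IsSection L.screen V →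
      IsSection (fun x => ⨆ α ∈ Finset.univ.erase 0, eigenDistribution S (lam α) x) V :=
    fun hV => ⟨hV.1, fun x => hS.screen_le_iSup hlam x (hV.2 x)⟩
  have hZu : IsSection (fun x => ⨆ α ∈ Finset.univ, eigenDistribution S (lam α) x) Z :=
    ⟨hZ, fun x => by simp [hS.iSup_eigenDistribution hlam]⟩
  have zero_left : ∀ w, L.g x 0 w = 0 := fun w => by rw [← gForm_apply]; simp
  have add_left : ∀ u v w, L.g x (u + v) w = L.g x u w + L.g x v w := fun u v w => by
    simp [← gForm_apply]
  refine hlam.section_induction hS.smooth (p := fun Z => L.g x (L.nablaEnd S X Y x) (Z x) = 0)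
    (by simp [← gForm_apply]) (fun V W _ _ hV hW => ?_) (fun γ _ Z hZ => ?_) hZu
  · rw [L.g_symm] at hV hW ⊢
    rw [Pi.add_apply, add_left, hV, hW, add_zero]
  by_cases hγ : γ = 0
  · rw [L.g_symm]
    refine L.g_rad ?_ _
    rw [← hlam.eigen_zero, ← hγ]
    exact hZ.2 x
  refine hlam.section_induction hS.smooth (p := fun X => L.g x (L.nablaEnd S X Y x) (Z x) = 0)
    ?_ (fun V W hV' hW' hV hW => ?_) (fun α hα X hX => ?_) (hdec hX)
  · rw [hL.nablaEnd_zero_dir hS.smooth hY.1, zero_left]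
  · rw [hL.nablaEnd_add_dir hS.smooth hV' hW' hY.1, add_left, hV, hW, add_zero]
  refine hlam.section_induction hS.smooth (p := fun Y => L.g x (L.nablaEnd S X Y x) (Z x) = 0)
    ?_ (fun V W hV' hW' hV hW => ?_) (fun β hβ Y hY => ?_) (hdec hY)
  · rw [hL.nablaEnd_zero hS.smooth hX.1, zero_left]
  · rw [hL.nablaEnd_add hS.smooth hX.1 hV' hW', add_left, hV, hW, add_zero]
  have hα := Finset.ne_of_mem_erase hα
  have hβ := Finset.ne_of_mem_erase hβ
  rw [hL.g_nablaEnd hS hlam hgrad (hS.isSection_screen hlam hα hX) hY hZ]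
  by_cases hβγ : β = γ
  · rw [hβγ, sub_self, zero_mul]
  · rw [hL.g_nabla_eq_zero hS hlam hgrad hprod hα hβ hγ hβγ hX hY hZ, mul_zero]

theorem ScreenTotallyGeodesic.nabla_mem_screen (h : L.ScreenTotallyGeodesic)
    (hX : IsSection L.screen X) (hY : IsSection L.screen Y) (x : M) :
    L.nabla X Y x ∈ L.screen x := by
  have hc := h X Y hX hY x
  unfold C screenSecondFundamentalForm at hc
  rw [show (fun y => L.P y (Y y)) = Y from funext fun y => L.P_of_mem (hY.2 y), ← ηForm_apply,
    map_sub, ηForm_apply, ηForm_apply, L.η_screen (L.P_mem x _), sub_zero] at hc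
  exact L.mem_screen_iff.2 hc

/-- A constant-coefficient combination of the local frame fields, which are globally smooth but span
the screen only near `x`. The extension need not be a section of the screen. -/
theorem exists_smoothField_eq (L : LightlikeHypersurface n N M) {x : M}
    {v : TangentSpace (𝓡 (n + 1)) x} (hv : v ∈ L.screen x) :
    ∃ V : ∀ x : M, TangentSpace (𝓡 (n + 1)) x, SmoothField V ∧ V x = v := by
  obtain ⟨r, hr⟩ := L.smooth_screen
  obtain ⟨V, hV, hev⟩ := hr x
  rw [← hev.self_of_nhds.2] at hv
  obtain ⟨c, hc⟩ := (Submodule.mem_span_range_iff_exists_fun ℝ).1 hv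
  exact ⟨∑ a, c a • V a, SmoothField.sum fun a _ => (hV a).const_smul (c a), by simpa using hc⟩

end LightlikeHypersurface
end NullGeometry

end

theorem corollary7p4 {n : ℕ}
    {N : Type*} [TopologicalSpace N] [T2Space N] [SecondCountableTopology N]
    [ChartedSpace (EuclideanSpace ℝ (Fin (n + 2))) N] [IsManifold (𝓡 (n + 2)) ∞ N]
    {M : Type*} [TopologicalSpace M] [T2Space M] [SecondCountableTopology M]
    [ChartedSpace (EuclideanSpace ℝ (Fin (n + 1))) M] [IsManifold (𝓡 (n + 1)) ∞ M]
    (L : NullGeometry.LightlikeHypersurface n N M) (hL : L.TotallyGeodesic)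
    (S : ∀ x : M, TangentSpace (𝓡 (n + 1)) x →L[ℝ] TangentSpace (𝓡 (n + 1)) x)
    (hS : L.IsATensor S)
    {k : ℕ} (lam : Fin (k + 1) → M → ℝ) (hlam : L.IsEigenfunctions S lam)
    (hgrad : ∀ α x, L.grad (lam α) x ∈ L.rad x)
    (hprod : NullGeometry.IntegrableAlmostProduct fun α => NullGeometry.eigenDistribution S (lam α))
    (hscreen : L.ScreenTotallyGeodesic) :
    ∀ X Y : ∀ x : M, TangentSpace (𝓡 (n + 1)) x,
      NullGeometry.IsSection L.screen X → NullGeometry.IsSection L.screen Y →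
        ∀ x, L.nablaEnd S X Y x = 0 := by
  intro X Y hX hY x
  have hmem : L.nablaEnd S X Y x ∈ L.screen x :=
    Submodule.sub_mem _
      (hscreen.nabla_mem_screen hX ⟨hS.smooth.apply hY.1, fun y => hS.apply_mem_screen (hY.2 y)⟩ x)
      (hS.apply_mem_screen (hscreen.nabla_mem_screen hX hY x))
  -- Extending the value of `∇S(X, Y)` at `x` allows pairing it with itself, which contradicts
  -- definiteness on the screen.
  obtain ⟨V, hV, hVx⟩ := L.exists_smoothField_eq hmem
  by_contra hne
  have hpos := L.flat_self_pos x _ hne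
  have h0 := hL.g_nablaEnd_eq_zero hS hlam hgrad hprod hX hY hV x
  rw [hVx] at h0
  rw [L.flat_screen hmem, h0] at hpos
  exact lt_irrefl _ hpos
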